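/- A \emph{lattice} is an additive subgroup $\Lambda\subseteq\mathbb{Z}^2$ of rank $2$; its index is $[\mathbb{Z}^2:\Lambda]$. A \emph{covering} of length $k$ is a collection $\mathcal C=\{\Lambda_1,\dots,\Lambda_k\}$ of $k$ lattices with $\Lambda_1\cup\dots\cup\Lambda_k=\mathbb{Z}^2$; the $\Lambda_i$ are its components, and coverings that differ only by the order of the components are identified. The covering is \emph{minimal} if, for every $i$ and every lattice $\Lambda_i'\subsetneq\Lambda_i$, the collection obtained from $\mathcal C$ by replacing $\Lambda_i$ by $\Lambda_i'$ is not a covering. Write $\begin{pmatrix}u_1&v_1\\u_2&v_2\end{pmatrix}$ for the lattice generated by the columns $(u_1,u_2)$ and $(v_1,v_2)$, and put $$\mathcal C_{4^6}=\left\{\begin{pmatrix}1&0\\0&4\end{pmatrix},\begin{pmatrix}4&0\\0&1\end{pmatrix},\begin{pmatrix}1&0\\1&4\end{pmatrix},\begin{pmatrix}1&0\\3&4\end{pmatrix},\begin{pmatrix}1&0\\2&4\end{pmatrix},\begin{pmatrix}2&0\\1&2\end{pmatrix}\right\},$$ $$\mathcal C_{5^6}=\left\{\begin{pmatrix}1&0\\0&5\end{pmatrix},\begin{pmatrix}5&0\\0&1\end{pmatrix},\begin{pmatrix}1&0\\1&5\end{pmatrix},\begin{pmatrix}1&0\\4&5\end{pmatrix},\begin{pmatrix}1&0\\2&5\end{pmatrix},\begin{pmatrix}1&0\\3&5\end{pmatrix}\right\}.$$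 There are exactly $40$ minimal coverings of length $6$. Among them, exactly two have all component indices at least $4$, namely $\mathcal C_{4^6}$ and $\mathcal C_{5^6}$. Moreover, $\mathcal C_{5^6}$ is the unique minimal covering of length $6$ with at least one component whose index is divisible by some prime $p\ge 5$. -/

import Mathlib

/-- A lattice: an additive subgroup of `ℤ²` of rank `2`. -/
def IsLattice (Λ : AddSubgroup (Fin 2 → ℤ)) : Prop :=
  Module.finrank ℤ Λ = 2

/-- A family of `k` lattices is a covering if its union is `ℤ²`. -/
def IsCovering {k : ℕ} (Λ : Fin k → AddSubgroup (Fin 2 → ℤ)) : Prop :=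
  (∀ i, IsLattice (Λ i)) ∧ (⋃ i, (Λ i : Set (Fin 2 → ℤ))) = Set.univ

/-- A covering is minimal if replacing any component by a proper sublattice of it
destroys the covering property. -/
def IsMinimalCovering {k : ℕ} (Λ : Fin k → AddSubgroup (Fin 2 → ℤ)) : Prop :=
  IsCovering Λ ∧
    ∀ (i : Fin k) (Λ' : AddSubgroup (Fin 2 → ℤ)), IsLattice Λ' → Λ' < Λ i →
      ¬ IsCovering (Function.update Λ i Λ')

/-- The minimal coverings `{Λ₁, …, Λₖ}` of length `k`, as (unordered) sets of lattices. The
components of a minimal covering are always distinct, so no multiplicity is lost. -/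
def minimalCoverings (k : ℕ) : Set (Set (AddSubgroup (Fin 2 → ℤ))) :=
  {C | ∃ Λ : Fin k → AddSubgroup (Fin 2 → ℤ), IsMinimalCovering Λ ∧ Set.range Λ = C}

/-- The subgroup of `ℤ²` generated by the two columns of a matrix. -/
def latticeOf (M : Matrix (Fin 2) (Fin 2) ℤ) : AddSubgroup (Fin 2 → ℤ) :=
  AddSubgroup.closure (Set.range M.col)

/-- The covering `𝒞_{4^6}`. -/
def coveringFour : Set (AddSubgroup (Fin 2 → ℤ)) :=
  {latticeOf !![1, 0; 0, 4], latticeOf !![4, 0; 0, 1], latticeOf !![1, 0; 1, 4],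
    latticeOf !![1, 0; 3, 4], latticeOf !![1, 0; 2, 4], latticeOf !![2, 0; 1, 2]}

/-- The covering `𝒞_{5^6}`. -/
def coveringFive : Set (AddSubgroup (Fin 2 → ℤ)) :=
  {latticeOf !![1, 0; 0, 5], latticeOf !![5, 0; 0, 1], latticeOf !![1, 0; 1, 5],
    latticeOf !![1, 0; 4, 5], latticeOf !![1, 0; 2, 5], latticeOf !![1, 0; 3, 5]}

/-!
A component of a minimal covering is generated by its private vectors, those in no other component,
so it contains a primitive vector `u`, and then it is `slopeLattice n u = {v | n ∣ det (u, v)}`,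
where `n` is its index. Such lattices are products over the primes `p` of balls in the projective
lines over the `p`-adic integers, and a covering of `ℤ²` is a covering of this product by boxes.
All facts about boxes that are used follow from the Plücker relation
`UnimodularMod.dvd_det2` and the Chinese remainder theorem, so the projective lines themselves do
not appear.

The indices are bounded by looking at the tree of balls at one prime `p`. If `p ^ a` divides the
index of a component `Λ`, then every ball branching off the path from the root to `Λ` contains a
component (`IsMinimalCover.exists_le_of_sibling`): a private vector of `Λ` can be moved into that
ball without changing it at the other primes, and a component containing the moved vector but not
contained in the ball would contain the original vector as well. There are `a * (p - 1) + 1` such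
disjoint balls, whence `a * (p - 1) + 2 ≤ 6`, and equality forces all indices to divide `p ^ a`
(`IsMinimalCover.prime_pow_bound`). Running the argument at `2` and `3` simultaneously excludes
an index divisible by `4` next to an index divisible by `3`
(`IsMinimalCover.not_four_dvd_and_three_dvd`). Hence all indices divide one of `5`, `6`, `9`, `16`
(`IsMinimalCover.index_dvd`).

For fixed `N`, a covering by lattices of index dividing `N` is a finite covering problem on the
projective line over `ℤ / N`, and minimality has a decidable criterion
(`isMinimalCover_coverOf`, `isTight_of_isMinimalCover`). An exhaustive search, in which each step
chooses the component through the first uncovered point (`exists_of_search`), shows that the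
minimal coverings are exactly the forty listed in `coverTable`, from which the remaining claims
are read off.
-/

/-! ### Determinants and lattices of the form `{v | n ∣ det (u, v)}` -/

/-- The determinant of the matrix with columns `u` and `v`. -/
def det2 (u v : Fin 2 → ℤ) : ℤ := u 0 * v 1 - u 1 * v 0

/-- `u` is unimodular modulo `n`: its coordinates generate the unit ideal of `ℤ / n`.
For `n = 0` this says that `u` is a primitive vector of `ℤ²`. -/
def UnimodularMod (n : ℤ) (u : Fin 2 → ℤ) : Prop := ∃ s t : ℤ, n ∣ s * u 0 + t * u 1 - 1

lemma UnimodularMod.mono {n m : ℤ} {u : Fin 2 → ℤ} (h : UnimodularMod n u) (hm : m ∣ n) :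
    UnimodularMod m u := by
  obtain ⟨s, t, hst⟩ := h
  exact ⟨s, t, hm.trans hst⟩

lemma IsCoprime.unimodularMod {u : Fin 2 → ℤ} (h : IsCoprime (u 0) (u 1)) (n : ℤ) :
    UnimodularMod n u := by
  obtain ⟨s, t, hst⟩ := h
  exact ⟨s, t, by simp [hst]⟩

lemma det2_swap (u v : Fin 2 → ℤ) : det2 v u = -det2 u v := by
  simp only [det2]; ring

lemma det2_self (u : Fin 2 → ℤ) : det2 u u = 0 := by
  simp only [det2]; ring

lemma det2_add (u v w : Fin 2 → ℤ) : det2 u (v + w) = det2 u v + det2 u w := by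
  simp only [det2, Pi.add_apply]; ring

lemma det2_smul (u v : Fin 2 → ℤ) (c : ℤ) : det2 u (c • v) = c * det2 u v := by
  simp only [det2, Pi.smul_apply, smul_eq_mul]; ring

lemma dvd_det2_comm {n : ℤ} {u v : Fin 2 → ℤ} : n ∣ det2 u v ↔ n ∣ det2 v u := by
  rw [det2_swap u v, dvd_neg]

/-- Proportionality modulo `n` is transitive through a unimodular vector. This is the Plücker
relation `det (v, w) u + det (w, u) v + det (u, v) w = 0`. -/
lemma UnimodularMod.dvd_det2 {n : ℤ} {u v w : Fin 2 → ℤ} (h : UnimodularMod n u)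
    (hv : n ∣ det2 u v) (hw : n ∣ det2 u w) : n ∣ det2 v w := by
  obtain ⟨s, t, k, hk⟩ := h
  have key : det2 v w = (s * v 0 + t * v 1) * det2 u w - (s * w 0 + t * w 1) * det2 u v
      - n * (k * det2 v w) := by
    rw [← mul_assoc, ← hk]; simp only [det2]; ring
  rw [key]
  exact dvd_sub (dvd_sub (hw.mul_left _) (hv.mul_left _)) (dvd_mul_right _ _)

/-- A vector of determinant `1` against a primitive vector. -/
lemma exists_det2_eq_one {u : Fin 2 → ℤ} (h : IsCoprime (u 0) (u 1)) :
    ∃ w : Fin 2 → ℤ, det2 u w = 1 := by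
  obtain ⟨s, t, hst⟩ := h
  exact ⟨![-t, s], by simp [det2]; linarith⟩

lemma isCoprime_of_det2_eq_one {u w : Fin 2 → ℤ} (h : det2 u w = 1) : IsCoprime (u 0) (u 1) :=
  ⟨w 1, -w 0, by simp only [det2] at h; linarith⟩

/-- A pair of determinant `1` is a basis of `ℤ²`. -/
lemma eq_smul_add_smul_of_det2_eq_one {u w : Fin 2 → ℤ} (h : det2 u w = 1) (v : Fin 2 → ℤ) :
    v = det2 v w • u + det2 u v • w := by
  simp only [det2] at h ⊢
  ext i
  fin_cases i <;> simp
  · linear_combination (-(v 0)) * h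
  · linear_combination (-(v 1)) * h

/-- Every vector is an integer multiple of a primitive one. -/
lemma exists_eq_smul_isCoprime (v : Fin 2 → ℤ) :
    ∃ (c : ℤ) (w : Fin 2 → ℤ), IsCoprime (w 0) (w 1) ∧ v = c • w := by
  by_cases h : v = 0
  · exact ⟨0, ![1, 0], by simpa using isCoprime_one_left, by simp [h]⟩
  have hg : Int.gcd (v 0) (v 1) ≠ 0 := by
    intro hg
    rw [Int.gcd_eq_zero_iff] at hg
    exact h (by ext i; fin_cases i; exacts [hg.1, hg.2])
  obtain ⟨a, b, hab, h0, h1⟩ := Int.exists_gcd_one (Nat.pos_of_ne_zero hg)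
  refine ⟨Int.gcd (v 0) (v 1), ![a, b], by simpa [Int.isCoprime_iff_gcd_eq_one] using hab, ?_⟩
  ext i
  fin_cases i
  · simpa [mul_comm] using h0
  · simpa [mul_comm] using h1

/-- The group of all vectors proportional to `u` modulo `n`. For primitive `u` it is the lattice
`ℤ u + n ℤ²`, and every lattice containing a primitive vector has this form. -/
def slopeLattice (n : ℕ) (u : Fin 2 → ℤ) : AddSubgroup (Fin 2 → ℤ) where
  carrier := {v | (n : ℤ) ∣ det2 u v}
  add_mem' {v w} hv hw := by
    simp only [Set.mem_ofPred_eq, det2_add] at *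
    exact dvd_add hv hw
  zero_mem' := by simp [det2]
  neg_mem' {v} hv := by
    have : det2 u (-v) = -det2 u v := by simp only [det2, Pi.neg_apply]; ring
    simpa only [Set.mem_ofPred_eq, this, dvd_neg] using hv

lemma mem_slopeLattice {n : ℕ} {u v : Fin 2 → ℤ} :
    v ∈ slopeLattice n u ↔ (n : ℤ) ∣ det2 u v := Iff.rfl

lemma self_mem_slopeLattice (n : ℕ) (u : Fin 2 → ℤ) : u ∈ slopeLattice n u := by
  simp [mem_slopeLattice, det2_self]

lemma mem_slopeLattice_comm {n : ℕ} {u v : Fin 2 → ℤ} :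
    v ∈ slopeLattice n u ↔ u ∈ slopeLattice n v := dvd_det2_comm

lemma UnimodularMod.slopeLattice_le {n m : ℕ} {u v : Fin 2 → ℤ} (h : UnimodularMod m v)
    (hv : v ∈ slopeLattice n u) (hm : n ∣ m) :
    slopeLattice m v ≤ slopeLattice n u := by
  intro w hw
  exact (h.mono (Int.natCast_dvd_natCast.2 hm)).dvd_det2 (dvd_det2_comm.1 hv)
    ((Int.natCast_dvd_natCast.2 hm).trans hw)

/-- Any vector of `slopeLattice n u` that is unimodular modulo `n` may replace `u`. -/
lemma slopeLattice_eq {n : ℕ} {u v : Fin 2 → ℤ} (hu : UnimodularMod n u) (hv : UnimodularMod n v)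
    (h : v ∈ slopeLattice n u) : slopeLattice n u = slopeLattice n v :=
  le_antisymm (hu.slopeLattice_le (mem_slopeLattice_comm.1 h) dvd_rfl)
    (hv.slopeLattice_le h dvd_rfl)

lemma index_slopeLattice {n : ℕ} {u : Fin 2 → ℤ} (h : IsCoprime (u 0) (u 1)) :
    (slopeLattice n u).index = n := by
  obtain ⟨w, hw⟩ := exists_det2_eq_one h
  let f : (Fin 2 → ℤ) →+ ZMod n :=
    { toFun := fun v => (det2 u v : ZMod n)
      map_zero' := by simp [det2]
      map_add' := fun v v' => by simp [det2_add] }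
  have hf : f.ker = slopeLattice n u := by
    ext v
    exact ZMod.intCast_zmod_eq_zero_iff_dvd _ _
  have hs : Function.Surjective f := by
    intro z
    obtain ⟨k, rfl⟩ := ZMod.intCast_surjective z
    refine ⟨k • w, ?_⟩
    change ((det2 u (k • w) : ℤ) : ZMod n) = _
    rw [det2_smul, hw, mul_one]
  rw [← hf, AddSubgroup.index_ker, AddMonoidHom.range_eq_top.2 hs]
  simp

lemma slopeLattice_le_iff_dvd {n m : ℕ} {u : Fin 2 → ℤ} (h : IsCoprime (u 0) (u 1)) :
    slopeLattice m u ≤ slopeLattice n u ↔ n ∣ m := by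
  refine ⟨fun hle => ?_, fun hd v hv => (Int.natCast_dvd_natCast.2 hd).trans hv⟩
  have := AddSubgroup.index_dvd_of_le hle
  rwa [index_slopeLattice h, index_slopeLattice h] at this

/-- A subgroup containing a primitive vector `u` is `slopeLattice n u`, with `n` its index. -/
lemma eq_slopeLattice {Λ : AddSubgroup (Fin 2 → ℤ)} {u : Fin 2 → ℤ}
    (h : IsCoprime (u 0) (u 1)) (hu : u ∈ Λ) : Λ = slopeLattice Λ.index u := by
  obtain ⟨w, hw⟩ := exists_det2_eq_one h
  -- The integers `k` with `k • w ∈ Λ` form a subgroup of `ℤ`, generated by some `m`.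
  obtain ⟨m, hm⟩ := Int.subgroup_cyclic (Λ.comap ((zmultiplesHom (Fin 2 → ℤ)) w))
  have key : Λ = slopeLattice m.natAbs u := by
    ext v
    rw [mem_slopeLattice, Int.natAbs_dvd, ← Int.mem_zmultiples_iff,
      AddSubgroup.zmultiples_eq_closure, ← hm, AddSubgroup.mem_comap, zmultiplesHom_apply]
    have hv := eq_smul_add_smul_of_det2_eq_one hw v
    conv_lhs => rw [hv]
    exact AddSubgroup.add_mem_cancel_left _ (Λ.zsmul_mem hu _)
  have hi := index_slopeLattice (n := m.natAbs) h
  rw [← key] at hi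
  rw [hi]
  exact key

lemma isLattice_iff_index_ne_zero {Λ : AddSubgroup (Fin 2 → ℤ)} :
    IsLattice Λ ↔ Λ.index ≠ 0 := by
  have h := Submodule.finiteQuotient_iff (AddSubgroup.toIntSubmodule Λ)
  rw [Module.finrank_fin_fun] at h
  exact h.symm.trans ((AddSubgroup.finiteIndex_iff_finite_quotient (H := Λ)).symm.trans
    AddSubgroup.finiteIndex_iff)

/-! ### Minimal coverings as sets of lattices -/

/-- A set of lattices that covers `ℤ²`, each component of which is generated by the vectors that
no other component contains (in the form: every proper sublattice misses such a vector). -/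
structure IsMinimalCover (C : Set (AddSubgroup (Fin 2 → ℤ))) : Prop where
  index_ne_zero : ∀ Λ ∈ C, Λ.index ≠ 0
  cover : ∀ v, ∃ Λ ∈ C, v ∈ Λ
  minimal : ∀ Λ ∈ C, ∀ Λ' < Λ, Λ'.index ≠ 0 → ∃ v, v ∉ Λ' ∧ ∀ M ∈ C, v ∈ M → M = Λ

lemma exists_lt_index_ne_zero {Λ : AddSubgroup (Fin 2 → ℤ)} (h : Λ.index ≠ 0) :
    ∃ Λ' < Λ, Λ'.index ≠ 0 := by
  set n := Λ.index with hn
  -- the vectors divisible by `2 * n`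
  refine ⟨slopeLattice (2 * n) ![1, 0] ⊓ slopeLattice (2 * n) ![0, 1],
    lt_of_le_of_ne ?_ ?_, AddSubgroup.index_inf_ne_zero ?_ ?_⟩
  · rintro v ⟨h1, h0⟩
    obtain ⟨b, hb⟩ : ((2 * n : ℕ) : ℤ) ∣ v 1 := by simpa [mem_slopeLattice, det2] using h1
    obtain ⟨a, ha⟩ : ((2 * n : ℕ) : ℤ) ∣ v 0 := by simpa [mem_slopeLattice, det2] using h0
    have : v = n • ![2 * a, 2 * b] := by
      ext i
      fin_cases i
      · simp [ha]; ring
      · simp [hb]; ring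
    rw [this]
    exact AddSubgroup.nsmul_index_mem Λ _
  · intro he
    have h1 : n • ![1, 0] ∈ Λ := AddSubgroup.nsmul_index_mem Λ _
    rw [← he] at h1
    have h2 : ((2 * n : ℕ) : ℤ) ∣ n := by simpa [mem_slopeLattice, det2] using h1.2
    have := Nat.le_of_dvd (Nat.pos_of_ne_zero h) (Int.natCast_dvd_natCast.1 h2)
    omega
  · rw [index_slopeLattice (by simpa using isCoprime_one_left)]; omega
  · rw [index_slopeLattice (by simpa using isCoprime_one_right)]; omega

lemma mem_minimalCoverings_iff {k : ℕ} (hk : k ≠ 0) {C : Set (AddSubgroup (Fin 2 → ℤ))} :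
    C ∈ minimalCoverings k ↔ IsMinimalCover C ∧ C.ncard = k := by
  constructor
  · rintro ⟨Λ, ⟨⟨hl, hc⟩, hm⟩, rfl⟩
    have hc' : ∀ v, ∃ i, v ∈ Λ i := fun v => by
      simpa using (Set.eq_univ_iff_forall.1 hc v)
    have key : ∀ i, ∀ Λ' < Λ i, Λ'.index ≠ 0 → ∃ v, v ∉ Λ' ∧ ∀ j, v ∈ Λ j → j = i := by
      intro i Λ' hlt hi
      by_contra! hcon
      have hL' := isLattice_iff_index_ne_zero.2 hi
      refine hm i Λ' hL' hlt ⟨fun j => ?_, Set.eq_univ_iff_forall.2 fun v => ?_⟩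
      · by_cases hj : j = i
        · subst hj; simpa using hL'
        · simpa [hj] using hl j
      · rw [Set.mem_iUnion]
        by_cases hv : v ∈ Λ'
        · exact ⟨i, by simpa using hv⟩
        · obtain ⟨j, hj, hji⟩ := hcon v hv
          exact ⟨j, by simpa [hji] using hj⟩
    have hinj : Function.Injective Λ := by
      intro i j hij
      obtain ⟨Λ', hlt, hi⟩ := exists_lt_index_ne_zero (isLattice_iff_index_ne_zero.1 (hl i))
      obtain ⟨v, -, hv⟩ := key i Λ' hlt hi
      obtain ⟨l, hlv⟩ := hc' v
      have := hv l hlv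
      subst this
      exact (hv j (hij ▸ hlv)).symm
    refine ⟨⟨?_, ?_, ?_⟩, ?_⟩
    · rintro _ ⟨i, rfl⟩
      exact isLattice_iff_index_ne_zero.1 (hl i)
    · intro v
      obtain ⟨i, hi⟩ := hc' v
      exact ⟨_, ⟨i, rfl⟩, hi⟩
    · rintro _ ⟨i, rfl⟩ Λ' hlt hi
      obtain ⟨v, hv, hv'⟩ := key i Λ' hlt hi
      refine ⟨v, hv, ?_⟩
      rintro _ ⟨j, rfl⟩ hj
      rw [hv' j hj]
    · rw [← Set.image_univ, Set.ncard_image_of_injective _ hinj]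
      simp
  · rintro ⟨hC, hn⟩
    have hfin : Finite C := Set.finite_of_ncard_ne_zero (hn ▸ hk)
    let e : Fin k ≃ C := (Finite.equivFinOfCardEq hn).symm
    refine ⟨fun i => (e i : AddSubgroup (Fin 2 → ℤ)), ⟨⟨fun i => ?_, ?_⟩, ?_⟩, ?_⟩
    · exact isLattice_iff_index_ne_zero.2 (hC.index_ne_zero _ (e i).2)
    · refine Set.eq_univ_iff_forall.2 fun v => Set.mem_iUnion.2 ?_
      obtain ⟨M, hM, hv⟩ := hC.cover v
      exact ⟨e.symm ⟨M, hM⟩, by simpa using hv⟩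
    · rintro i Λ' hl hlt ⟨-, hcov⟩
      obtain ⟨v, hv, hv'⟩ := hC.minimal _ (e i).2 Λ' hlt (isLattice_iff_index_ne_zero.1 hl)
      obtain ⟨j, hj⟩ := Set.mem_iUnion.1 (Set.eq_univ_iff_forall.1 hcov v)
      by_cases hji : j = i
      · subst hji
        exact hv (by simpa using hj)
      · rw [Function.update_of_ne hji] at hj
        exact hji (e.injective (Subtype.ext (hv' _ (e j).2 hj)))
    · ext M
      simp only [Set.mem_range]
      exact ⟨fun ⟨i, hi⟩ => hi ▸ (e i).2, fun hM => ⟨e.symm ⟨M, hM⟩, by simp⟩⟩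

/-- `v` is a primitive vector contained in the member `Λ` of `C` and in no other one. -/
structure IsPrivateVector (C : Set (AddSubgroup (Fin 2 → ℤ))) (Λ : AddSubgroup (Fin 2 → ℤ))
    (v : Fin 2 → ℤ) : Prop where
  isCoprime : IsCoprime (v 0) (v 1)
  mem : v ∈ Λ
  eq : ∀ M ∈ C, v ∈ M → M = Λ

namespace IsMinimalCover

variable {C : Set (AddSubgroup (Fin 2 → ℤ))} {Λ : AddSubgroup (Fin 2 → ℤ)}

lemma exists_isPrivateVector (hC : IsMinimalCover C) (hΛ : Λ ∈ C) :
    ∃ v, IsPrivateVector C Λ v := by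
  obtain ⟨Λ', hlt, hi⟩ := exists_lt_index_ne_zero (hC.index_ne_zero Λ hΛ)
  obtain ⟨v, -, hv⟩ := hC.minimal Λ hΛ Λ' hlt hi
  obtain ⟨c, w, hw, rfl⟩ := exists_eq_smul_isCoprime v
  have hw' : ∀ M ∈ C, w ∈ M → M = Λ := fun M hM hwM => hv M hM (M.zsmul_mem hwM c)
  obtain ⟨M, hM, hwM⟩ := hC.cover w
  exact ⟨w, hw, hw' M hM hwM ▸ hwM, hw'⟩

lemma index_ne_one (hC : IsMinimalCover C) (h2 : 2 ≤ C.ncard) (hΛ : Λ ∈ C) : Λ.index ≠ 1 := by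
  intro h1
  rw [AddSubgroup.index_eq_one] at h1
  obtain ⟨M, hM, hne⟩ := Set.exists_ne_of_one_lt_ncard h2 Λ
  obtain ⟨v, hv⟩ := hC.exists_isPrivateVector hM
  exact hne (hv.eq Λ hΛ (h1 ▸ AddSubgroup.mem_top v)).symm

end IsMinimalCover

lemma IsPrivateVector.eq_slopeLattice {C : Set (AddSubgroup (Fin 2 → ℤ))}
    {Λ : AddSubgroup (Fin 2 → ℤ)} {v : Fin 2 → ℤ} (hv : IsPrivateVector C Λ v) :
    Λ = slopeLattice Λ.index v :=
  _root_.eq_slopeLattice hv.isCoprime hv.mem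

/-! ### Siblings: the neighbours of a lattice in the `p`-adic tree -/

/-- Index set for the siblings at a prime `p` of a lattice whose index is divisible by `p ^ a`:
the vertices of the `p`-adic tree of `ℤ²` that branch off its ancestors of level `< a`. There are
`p` of them on the first level (one of which is `none`) and `p - 1` on each further level. -/
abbrev SiblingIndex (p a : ℕ) : Type := Option (Fin a × Fin (p - 1))

namespace SiblingIndex

variable {p a : ℕ}

/-- The level of the ancestor from which the sibling branches off. -/
def level : SiblingIndex p a → ℕ
  | none => 0
  | some (j, _) => j

/-- The direction of a sibling of `slopeLattice (p ^ a) v`, for a basis `(v, w)` of `ℤ²`. The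
sibling itself is `slopeLattice (p ^ (level x + 1)) (vec v w x)`. -/
def vec (v w : Fin 2 → ℤ) : SiblingIndex p a → Fin 2 → ℤ
  | none => w
  | some (j, c) => v + (((c : ℤ) + 1) * (p : ℤ) ^ (j : ℕ)) • w

lemma level_lt (ha : a ≠ 0) (x : SiblingIndex p a) : x.level < a := by
  rcases x with _ | ⟨j, c⟩
  · exact Nat.pos_of_ne_zero ha
  · exact j.2

variable {v w : Fin 2 → ℤ}

lemma exists_det2_vec_eq_one (h : det2 v w = 1) (x : SiblingIndex p a) :
    ∃ z, det2 (x.vec v w) z = 1 := by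
  rcases x with _ | ⟨j, c⟩
  · exact ⟨-v, by simp only [det2, vec, Pi.neg_apply] at *; linarith⟩
  · refine ⟨w, ?_⟩
    rw [← h]
    simp only [det2, vec, Pi.add_apply, Pi.smul_apply, smul_eq_mul]
    ring

lemma isCoprime_vec (h : det2 v w = 1) (x : SiblingIndex p a) :
    IsCoprime (x.vec v w 0) (x.vec v w 1) :=
  isCoprime_of_det2_eq_one (exists_det2_vec_eq_one h x).choose_spec

lemma det2_vec_some (h : det2 v w = 1) (j : Fin a) (c : Fin (p - 1)) :
    det2 v (vec v w (some (j, c))) = ((c : ℤ) + 1) * (p : ℤ) ^ (j : ℕ) := by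
  rw [vec, det2_add, det2_self, det2_smul, h, mul_one, zero_add]

lemma pow_level_dvd (h : det2 v w = 1) (x : SiblingIndex p a) :
    (p : ℤ) ^ x.level ∣ det2 v (x.vec v w) := by
  rcases x with _ | ⟨j, c⟩
  · simp [level]
  · rw [det2_vec_some h]
    exact dvd_mul_left _ _

lemma not_dvd_succ_mul_pow (hp : p.Prime) (j : ℕ) (c : Fin (p - 1)) :
    ¬ (p : ℤ) ^ (j + 1) ∣ ((c : ℤ) + 1) * (p : ℤ) ^ j := by
  rw [pow_succ', mul_dvd_mul_iff_right (pow_ne_zero _ (by exact_mod_cast hp.ne_zero))]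
  intro hd
  have := Nat.le_of_dvd (Nat.succ_pos c) (by exact_mod_cast hd)
  have := c.2
  omega

lemma not_pow_dvd_self (hp : p.Prime) (h : det2 v w = 1) (x : SiblingIndex p a) :
    ¬ (p : ℤ) ^ (x.level + 1) ∣ det2 v (x.vec v w) := by
  rcases x with _ | ⟨j, c⟩
  · rw [vec, h, level, zero_add, pow_one]
    exact fun hd => hp.one_lt.ne' (by exact_mod_cast Int.eq_one_of_dvd_one (by positivity) hd)
  · rw [det2_vec_some h]
    exact not_dvd_succ_mul_pow hp _ _

/-- Distinct siblings are disjoint: no vector unimodular modulo `p` lies in both. -/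
lemma eq_of_pow_dvd (hp : p.Prime) (h : det2 v w = 1) (x y : SiblingIndex p a)
    (hd : (p : ℤ) ^ (min x.level y.level + 1) ∣ det2 (x.vec v w) (y.vec v w)) : x = y := by
  have h1 : ∀ j c, det2 w (vec v w (some (j, c) : SiblingIndex p a)) = -1 := fun j c => by
    rw [vec, det2_add, det2_smul, det2_self, mul_zero, add_zero, det2_swap, h]
  have hp1 : ¬ (p : ℤ) ∣ -1 := fun hd => hp.one_lt.ne'
    (by exact_mod_cast Int.eq_one_of_dvd_one (by positivity) (dvd_neg.1 hd))
  -- For `j < j'` the determinant is exactly divisible by `p ^ j`.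
  have h2 : ∀ (j j' : Fin a) (c c' : Fin (p - 1)), j < j' → ¬ (p : ℤ) ^ ((j : ℕ) + 1) ∣
      det2 (vec v w (some (j, c) : SiblingIndex p a)) (vec v w (some (j', c'))) := by
    intro j j' c c' hj hd
    apply not_dvd_succ_mul_pow hp j c
    have e : ((c : ℤ) + 1) * (p : ℤ) ^ (j : ℕ) =
        ((c' : ℤ) + 1) * (p : ℤ) ^ (j' : ℕ) -
          det2 (vec v w (some (j, c) : SiblingIndex p a)) (vec v w (some (j', c'))) := by
      simp only [det2, vec, Pi.add_apply, Pi.smul_apply, smul_eq_mul] at h ⊢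
      linear_combination ((((c' : ℤ) + 1) * (p : ℤ) ^ (j' : ℕ)) -
        ((c : ℤ) + 1) * (p : ℤ) ^ (j : ℕ)) * h
    rw [e]
    exact dvd_sub ((pow_dvd_pow _ (by exact hj)).mul_left _) hd
  rcases x with _ | ⟨j, c⟩ <;> rcases y with _ | ⟨j', c'⟩
  · rfl
  · simp only [level, vec.eq_1, h1, Nat.zero_min, zero_add, pow_one] at hd
    exact absurd hd hp1
  · simp only [level, vec.eq_1, Nat.min_zero, zero_add, pow_one] at hd
    rw [dvd_det2_comm, h1] at hd
    exact absurd hd hp1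
  · simp only [level] at hd
    rcases lt_trichotomy j j' with hj | rfl | hj
    · rw [min_eq_left (by exact hj.le)] at hd
      exact absurd hd (h2 _ _ _ _ hj)
    · have e : det2 (vec v w (some (j, c) : SiblingIndex p a)) (vec v w (some (j, c'))) =
          ((c' : ℤ) - c) * (p : ℤ) ^ (j : ℕ) := by
        simp only [det2, vec, Pi.add_apply, Pi.smul_apply, smul_eq_mul] at h ⊢
        linear_combination (((c' : ℤ) - c) * (p : ℤ) ^ (j : ℕ)) * h
      rw [e, min_self, pow_succ', mul_dvd_mul_iff_right
        (pow_ne_zero _ (by exact_mod_cast hp.ne_zero))] at hd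
      have hc := c.2
      have hc' := c'.2
      have : (c' : ℤ) - c = 0 := Int.eq_zero_of_abs_lt_dvd hd (by rw [abs_lt]; omega)
      have : c = c' := Fin.ext (by omega)
      rw [this]
    · rw [min_eq_right (by exact hj.le), dvd_det2_comm] at hd
      exact absurd hd (h2 _ _ _ _ hj)

end SiblingIndex

lemma card_siblingIndex (p a : ℕ) : Nat.card (SiblingIndex p a) = a * (p - 1) + 1 := by
  simp [Nat.card_eq_fintype_card]

/-- If a subgroup with a primitive vector lies in two slope lattices, then their directions agree
modulo any common divisor of the moduli. -/
lemma dvd_det2_of_le {Λ : AddSubgroup (Fin 2 → ℤ)} {u x y : Fin 2 → ℤ} {n m : ℕ} {d : ℤ}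
    (hu : IsCoprime (u 0) (u 1)) (hΛ : u ∈ Λ) (hx : Λ ≤ slopeLattice n x)
    (hy : Λ ≤ slopeLattice m y) (hn : d ∣ n) (hm : d ∣ m) : d ∣ det2 x y :=
  (hu.unimodularMod d).dvd_det2 (hn.trans (mem_slopeLattice_comm.1 (hx hΛ)))
    (hm.trans (mem_slopeLattice_comm.1 (hy hΛ)))

namespace IsMinimalCover

variable {C : Set (AddSubgroup (Fin 2 → ℤ))} {Λ : AddSubgroup (Fin 2 → ℤ)} {v w : Fin 2 → ℤ}

/-- Every sibling of a component contains a component. By the Chinese remainder theorem a private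
vector `v` of `Λ` can be modified at `p` alone so as to land in the sibling. A component
containing the modified vector would contain `v` if it were not itself inside the sibling. Its
part prime to `p` contains `v`. -/
lemma exists_le_of_sibling (hC : IsMinimalCover C) (hfin : C.Finite)
    (hv : IsPrivateVector C Λ v) {p j : ℕ} (hp : p.Prime) (hj : p ^ (j + 1) ∣ Λ.index)
    {y : Fin 2 → ℤ} (hy : IsCoprime (y 0) (y 1)) (hvy : (p : ℤ) ^ j ∣ det2 v y) :
    ∃ M ∈ C, M ≤ slopeLattice (p ^ (j + 1)) y ∧
      ∀ m : ℕ, m.Coprime p → m ∣ M.index → M ≤ slopeLattice m v := by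
  set D := ∏ M ∈ hfin.toFinset, M.index with hD
  have hD0 : D ≠ 0 := Finset.prod_ne_zero_iff.2 fun M hM =>
    hC.index_ne_zero M (hfin.mem_toFinset.1 hM)
  have hdvd : ∀ M ∈ C, M.index ∣ D := fun M hM =>
    Finset.dvd_prod_of_mem _ (hfin.mem_toFinset.2 hM)
  obtain ⟨f, E, hE, hDE⟩ := Nat.exists_eq_pow_mul_and_not_dvd hD0 p hp.ne_one
  have hcop : IsCoprime ((p : ℤ) ^ (j + 1)) (E : ℤ) :=
    (Nat.isCoprime_iff_coprime.2 ((Nat.Prime.coprime_iff_not_dvd hp).2 hE)).pow_left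
  obtain ⟨a, b, hab⟩ := hcop
  -- `z` is congruent to `y` modulo `p ^ (j + 1)` and to `v` modulo `E`.
  set z : Fin 2 → ℤ := (b * E) • y + (a * (p : ℤ) ^ (j + 1)) • v with hz
  have hdet : ∀ u, det2 u z = b * E * det2 u y + a * (p : ℤ) ^ (j + 1) * det2 u v := fun u => by
    rw [hz, det2_add, det2_smul, det2_smul]
  obtain ⟨M, hM, hzM⟩ := hC.cover z
  obtain ⟨u, hu⟩ := hC.exists_isPrivateVector hM
  have hMu := hu.eq_slopeLattice
  rw [hMu, mem_slopeLattice] at hzM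
  have hA : ∀ m : ℕ, m.Coprime p → m ∣ M.index → (m : ℤ) ∣ det2 u v := by
    intro m hm hmM
    have hmE : (m : ℤ) ∣ E := Int.natCast_dvd_natCast.2 <|
      (hm.pow_right f).dvd_of_dvd_mul_left (hDE ▸ hmM.trans (hdvd M hM))
    have e : det2 u v = det2 u z - b * E * (det2 u y - det2 u v) := by
      rw [hdet]; linear_combination (-det2 u v) * hab
    rw [e]
    exact dvd_sub ((Int.natCast_dvd_natCast.2 hmM).trans hzM)
      ((hmE.mul_left b).mul_right _)
  have hP : ∀ i ≤ j + 1, p ^ i ∣ M.index → (p : ℤ) ^ i ∣ det2 u y := by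
    intro i hi hpi
    have e : det2 u y = det2 u z - a * (p : ℤ) ^ (j + 1) * (det2 u v - det2 u y) := by
      rw [hdet]; linear_combination (-det2 u y) * hab
    rw [e]
    refine dvd_sub (dvd_trans (by exact_mod_cast Int.natCast_dvd_natCast.2 hpi) hzM)
      (((pow_dvd_pow _ hi).mul_left a).mul_right _)
  have hB : p ^ (j + 1) ∣ M.index := by
    by_contra hnot
    obtain ⟨g, m, hm, hgm⟩ := Nat.exists_eq_pow_mul_and_not_dvd (hC.index_ne_zero M hM) p hp.ne_one
    have hg : g ≤ j := by
      by_contra! hg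
      exact hnot (hgm ▸ (pow_dvd_pow p hg).mul_right m)
    have hmp : m.Coprime p := ((Nat.Prime.coprime_iff_not_dvd hp).2 hm).symm
    have h1 : (p : ℤ) ^ g ∣ det2 u v := dvd_det2_comm.1 <|
      (hy.unimodularMod _).dvd_det2 ((pow_dvd_pow _ hg).trans (dvd_det2_comm.1 hvy))
        (dvd_det2_comm.1 (hP g (by omega) (hgm ▸ dvd_mul_right _ _)))
    have h2 : (m : ℤ) ∣ det2 u v := hA m hmp (hgm ▸ dvd_mul_left _ _)
    have h3 : v ∈ M := by
      rw [hMu, mem_slopeLattice, hgm]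
      push_cast
      exact IsCoprime.mul_dvd
        (by exact_mod_cast Nat.isCoprime_iff_coprime.2 (hmp.symm.pow_left g)) h1 h2
    exact hnot (hv.eq M hM h3 ▸ hj)
  have hle : ∀ (m : ℕ) (x : Fin 2 → ℤ), m ∣ M.index → (m : ℤ) ∣ det2 u x →
      M ≤ slopeLattice m x := by
    intro m x hm hx t ht
    rw [hMu, mem_slopeLattice] at ht
    exact (hu.isCoprime.unimodularMod m).dvd_det2 hx ((Int.natCast_dvd_natCast.2 hm).trans ht)
  exact ⟨M, hM, hle _ y hB (by exact_mod_cast hP (j + 1) le_rfl hB),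
    fun m hm hmM => hle m v hmM (hA m hm hmM)⟩

/-- A choice of components inside the siblings of the component `Λ`. -/
lemma exists_siblings (hC : IsMinimalCover C) (hfin : C.Finite)
    (hv : IsPrivateVector C Λ v) (hw : det2 v w = 1) {p a : ℕ} (hp : p.Prime) (ha : a ≠ 0)
    (hd : p ^ a ∣ Λ.index) :
    ∃ f : SiblingIndex p a → AddSubgroup (Fin 2 → ℤ), ∀ x, f x ∈ C ∧
      f x ≤ slopeLattice (p ^ (x.level + 1)) (x.vec v w) ∧
      ∀ m : ℕ, m.Coprime p → m ∣ (f x).index → f x ≤ slopeLattice m v := by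
  have := fun x : SiblingIndex p a => hC.exists_le_of_sibling hfin hv (j := x.level) hp
    ((pow_dvd_pow p (x.level_lt ha)).trans hd) (x.isCoprime_vec hw) (x.pow_level_dvd hw)
  choose f hf using this
  exact ⟨f, hf⟩

/-- A component lies in at most one sibling. -/
lemma sibling_eq (hC : IsMinimalCover C) {M : AddSubgroup (Fin 2 → ℤ)} (hM : M ∈ C)
    (hw : det2 v w = 1) {p a : ℕ} (hp : p.Prime) {x y : SiblingIndex p a}
    (hx : M ≤ slopeLattice (p ^ (x.level + 1)) (x.vec v w))
    (hy : M ≤ slopeLattice (p ^ (y.level + 1)) (y.vec v w)) : x = y := by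
  obtain ⟨u, hu⟩ := hC.exists_isPrivateVector hM
  refine SiblingIndex.eq_of_pow_dvd hp hw x y (dvd_det2_of_le hu.isCoprime hu.mem hx hy ?_ ?_)
  · push_cast
    exact pow_dvd_pow _ (by omega)
  · push_cast
    exact pow_dvd_pow _ (by omega)

/-- A component that lies in `slopeLattice (p ^ n) v` lies in no sibling of level less than `n`. -/
lemma not_le_sibling (hC : IsMinimalCover C) {M : AddSubgroup (Fin 2 → ℤ)} (hM : M ∈ C)
    (hw : det2 v w = 1) {p a n : ℕ} (hp : p.Prime) {x : SiblingIndex p a}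
    (hn : x.level < n) (hv : M ≤ slopeLattice (p ^ n) v) :
    ¬ M ≤ slopeLattice (p ^ (x.level + 1)) (x.vec v w) := by
  intro hx
  obtain ⟨u, hu⟩ := hC.exists_isPrivateVector hM
  refine SiblingIndex.not_pow_dvd_self hp hw x
    (dvd_det2_of_le hu.isCoprime hu.mem hv hx ?_ ?_)
  · push_cast
    exact pow_dvd_pow _ hn
  · push_cast
    rfl

end IsMinimalCover

/-! ### The indices of a minimal covering of length six -/

namespace IsMinimalCover

variable {C : Set (AddSubgroup (Fin 2 → ℤ))} {Λ : AddSubgroup (Fin 2 → ℤ)}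

/-- A minimal covering with a component of index divisible by `p ^ a` has at least
`2 + a * (p - 1)` components: one in each sibling and the given one. In case of equality every
primitive vector of a sibling lies in the only component inside this sibling, so that all
indices are powers of `p`. -/
lemma prime_pow_bound (hC : IsMinimalCover C) (hfin : C.Finite) (hΛ : Λ ∈ C) {p a : ℕ}
    (hp : p.Prime) (ha : a ≠ 0) (hd : p ^ a ∣ Λ.index) :
    a * (p - 1) + 2 ≤ C.ncard ∧
      (C.ncard = a * (p - 1) + 2 → ∀ M ∈ C, M.index ∣ p ^ a) := by
  obtain ⟨v, hv⟩ := hC.exists_isPrivateVector hΛ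
  obtain ⟨w, hw⟩ := exists_det2_eq_one hv.isCoprime
  obtain ⟨f, hf⟩ := hC.exists_siblings hfin hv hw hp ha hd
  have hΛa : Λ ≤ slopeLattice (p ^ a) v := by
    conv_lhs => rw [hv.eq_slopeLattice]
    exact (slopeLattice_le_iff_dvd hv.isCoprime).2 hd
  -- Level, direction and component of each leaf of the tree, `none` standing for `Λ`.
  let e : Option (SiblingIndex p a) → ℕ := fun x => x.elim a fun x => x.level + 1
  let y : Option (SiblingIndex p a) → Fin 2 → ℤ := fun x => x.elim v fun x => x.vec v w
  let g : Option (SiblingIndex p a) → AddSubgroup (Fin 2 → ℤ) := fun x => x.elim Λ f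
  have hg : ∀ x, g x ∈ C := by rintro (_ | x); exacts [hΛ, (hf x).1]
  have hgle : ∀ x, g x ≤ slopeLattice (p ^ e x) (y x) := by
    rintro (_ | x); exacts [hΛa, (hf x).2.1]
  have hea : ∀ x, e x ≤ a := by rintro (_ | x); exacts [le_rfl, x.level_lt ha]
  have hy : ∀ x, ∃ z, det2 (y x) z = 1 := by
    rintro (_ | x); exacts [⟨w, hw⟩, x.exists_det2_vec_eq_one hw]
  have hsep : ∀ x x' (u : Fin 2 → ℤ), IsCoprime (u 0) (u 1) → u ∈ slopeLattice (p ^ e x) (y x) →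
      u ∈ slopeLattice (p ^ e x') (y x') → x = x' := by
    have hsep' : ∀ d n m (u z t : Fin 2 → ℤ), IsCoprime (u 0) (u 1) → u ∈ slopeLattice (p ^ n) z →
        u ∈ slopeLattice (p ^ m) t → d ≤ n → d ≤ m → (p : ℤ) ^ d ∣ det2 z t := by
      intro d n m u z t hu hz ht hn hm
      rw [mem_slopeLattice, dvd_det2_comm] at hz ht
      push_cast at hz ht
      exact (hu.unimodularMod _).dvd_det2 ((pow_dvd_pow _ hn).trans hz)
        ((pow_dvd_pow _ hm).trans ht)
    rintro (_ | x) (_ | x') u hu hux hux'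
    · rfl
    · exact absurd (hsep' _ _ _ u _ _ hu hux hux' (x'.level_lt ha) le_rfl)
        (SiblingIndex.not_pow_dvd_self hp hw x')
    · exact absurd (hsep' _ _ _ u _ _ hu hux' hux (x.level_lt ha) le_rfl)
        (SiblingIndex.not_pow_dvd_self hp hw x)
    · rw [SiblingIndex.eq_of_pow_dvd hp hw x x' (hsep' _ _ _ u _ _ hu hux hux'
        (by simp only [e, Option.elim]; omega) (by simp only [e, Option.elim]; omega))]
  let G : Option (SiblingIndex p a) → C := fun x => ⟨g x, hg x⟩
  have hG : Function.Injective G := by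
    intro x x' hxx
    have hxx' : g x = g x' := congrArg Subtype.val hxx
    obtain ⟨u, hu⟩ := hC.exists_isPrivateVector (hg x)
    exact hsep x x' u hu.isCoprime (hgle x hu.mem) (hgle x' (hxx' ▸ hu.mem))
  have hcard : Nat.card (Option (SiblingIndex p a)) = a * (p - 1) + 2 := by
    rw [Finite.card_option, card_siblingIndex]
  have := hfin.to_subtype
  refine ⟨hcard ▸ Nat.card_le_card_of_injective G hG, fun heq M hM => ?_⟩
  have hbij : Function.Bijective G :=
    hG.bijective_of_nat_card_le (by rw [hcard]; exact heq.le)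
  obtain ⟨x, hx⟩ := hbij.2 ⟨M, hM⟩
  have hx : g x = M := congrArg Subtype.val hx
  -- Every primitive vector of the sibling belongs to the component.
  have hprim : ∀ u : Fin 2 → ℤ, IsCoprime (u 0) (u 1) → u ∈ slopeLattice (p ^ e x) (y x) →
      u ∈ M := by
    intro u hu hux
    obtain ⟨N, hN, huN⟩ := hC.cover u
    obtain ⟨x', hx'⟩ := hbij.2 ⟨N, hN⟩
    have hx' : g x' = N := congrArg Subtype.val hx'
    rw [← hx, hsep x x' u hu hux (hgle x' (hx' ▸ huN)), hx']
    exact huN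
  obtain ⟨z, hz⟩ := hy x
  have hyc := isCoprime_of_det2_eq_one hz
  have h1 : y x ∈ M := hprim _ hyc (self_mem_slopeLattice _ _)
  have hdet : det2 (y x) (y x + (p : ℤ) ^ e x • z) = (p : ℤ) ^ e x := by
    rw [det2_add, det2_self, det2_smul, hz, zero_add, mul_one]
  have h2 : y x + (p : ℤ) ^ e x • z ∈ M := by
    refine hprim _ (isCoprime_of_det2_eq_one (w := z) ?_) ?_
    · rw [← hz]
      simp only [det2, Pi.add_apply, Pi.smul_apply, smul_eq_mul]
      ring
    · rw [mem_slopeLattice, hdet]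
      push_cast
      rfl
  rw [eq_slopeLattice hyc h1, mem_slopeLattice, hdet] at h2
  exact dvd_trans (by exact_mod_cast h2) (pow_dvd_pow p (hea x))

/-- Siblings of one component at two different primes together: if `p ^ a * q ^ b` divides the
index of `Λ`, then the components chosen inside the siblings at `p` and at `q` are distinct. -/
lemma exists_siblings_two_primes (hC : IsMinimalCover C) (hfin : C.Finite) (hΛ : Λ ∈ C)
    {p q a b : ℕ} (hp : p.Prime) (hq : q.Prime) (hpq : p ≠ q) (ha : a ≠ 0) (hb : b ≠ 0)
    (hda : p ^ a ∣ Λ.index) (hdb : q ^ b ∣ Λ.index) :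
    ∃ v w : Fin 2 → ℤ, det2 v w = 1 ∧ IsPrivateVector C Λ v ∧
      ∃ g : Option (SiblingIndex p a ⊕ SiblingIndex q b) → C, Function.Injective g ∧
        (g none : AddSubgroup (Fin 2 → ℤ)) = Λ ∧
        (∀ x, (g (some (.inl x)) : AddSubgroup (Fin 2 → ℤ)) ≤
          slopeLattice (p ^ (x.level + 1)) (x.vec v w)) ∧
        ∀ x, (g (some (.inr x)) : AddSubgroup (Fin 2 → ℤ)) ≤
          slopeLattice (q ^ (x.level + 1)) (x.vec v w) ∧
          (p ∣ (g (some (.inr x)) : AddSubgroup (Fin 2 → ℤ)).index →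
            (g (some (.inr x)) : AddSubgroup (Fin 2 → ℤ)) ≤ slopeLattice p v) := by
  obtain ⟨v, hv⟩ := hC.exists_isPrivateVector hΛ
  obtain ⟨w, hw⟩ := exists_det2_eq_one hv.isCoprime
  obtain ⟨f, hf⟩ := hC.exists_siblings hfin hv hw hp ha hda
  obtain ⟨h, hh⟩ := hC.exists_siblings hfin hv hw hq hb hdb
  have hle : ∀ {n}, n ∣ Λ.index → Λ ≤ slopeLattice n v := fun hn => by
    conv_lhs => rw [hv.eq_slopeLattice]
    exact (slopeLattice_le_iff_dvd hv.isCoprime).2 hn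
  have hpf : ∀ x, f x ≠ Λ := fun x he =>
    hC.not_le_sibling hΛ hw hp (x.level_lt ha) (hle hda) (he ▸ (hf x).2.1)
  have hqh : ∀ x, h x ≠ Λ := fun x he =>
    hC.not_le_sibling hΛ hw hq (x.level_lt hb) (hle hdb) (he ▸ (hh x).2.1)
  have hfh : ∀ x y, f x ≠ h y := by
    intro x y he
    obtain ⟨u, hu⟩ := hC.exists_isPrivateVector (hf x).1
    have hdvd : p ^ (x.level + 1) ∣ (f x).index := by
      have := AddSubgroup.index_dvd_of_le (hf x).2.1
      rwa [index_slopeLattice (x.isCoprime_vec hw)] at this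
    have h1 := (hh y).2.2 (p ^ (x.level + 1))
      (((Nat.coprime_primes hp hq).2 hpq).pow_left _) (he ▸ hdvd)
    refine hC.not_le_sibling (hf x).1 hw hp (Nat.lt_succ_self _) ?_ (hf x).2.1
    rw [he]
    exact h1
  refine ⟨v, w, hw, hv, fun x => x.elim ⟨Λ, hΛ⟩ (Sum.elim (fun x => ⟨f x, (hf x).1⟩)
    fun x => ⟨h x, (hh x).1⟩), ?_, rfl, fun x => (hf x).2.1, fun x => ⟨(hh x).2.1, fun hd =>
    (hh x).2.2 p ((Nat.coprime_primes hp hq).2 hpq) hd⟩⟩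
  rintro (_ | x | x) (_ | y | y) hxy <;>
    simp only [Option.elim, Sum.elim_inl, Sum.elim_inr, Subtype.mk.injEq] at hxy
  · rfl
  · exact absurd hxy.symm (hpf y)
  · exact absurd hxy.symm (hqh y)
  · exact absurd hxy (hpf x)
  · rw [hC.sibling_eq (hf x).1 hw hp (hf x).2.1 (hxy ▸ (hf y).2.1)]
  · exact absurd hxy (hfh x y)
  · exact absurd hxy (hqh x)
  · exact absurd hxy.symm (hfh y x)
  · rw [hC.sibling_eq (hh x).1 hw hq (hh x).2.1 (hxy ▸ (hh y).2.1)]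

lemma card_two_primes (p q a b : ℕ) : Nat.card (Option (SiblingIndex p a ⊕ SiblingIndex q b)) =
    a * (p - 1) + b * (q - 1) + 3 := by
  rw [Finite.card_option, Nat.card_sum, card_siblingIndex, card_siblingIndex]
  ring

/-- A minimal covering of length six cannot involve both an index divisible by `4` and an index
divisible by `3`. -/
lemma not_four_dvd_and_three_dvd (hC : IsMinimalCover C) (h6 : C.ncard = 6)
    (h24 : ∀ M ∈ C, M.index ∣ 24) (hΛ : Λ ∈ C) (h4 : 4 ∣ Λ.index)
    {M : AddSubgroup (Fin 2 → ℤ)} (hM : M ∈ C) (h3 : 3 ∣ M.index) : False := by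
  have hfin : C.Finite := Set.finite_of_ncard_ne_zero (by omega)
  have := hfin.to_subtype
  have hcard : Nat.card C = 6 := h6
  have h12 : ∀ N ∈ C, 4 ∣ N.index → ¬ 3 ∣ N.index := by
    intro N hN hN4 hN3
    obtain ⟨_, _, _, _, g, hg, -⟩ := hC.exists_siblings_two_primes hfin hN (a := 2) (b := 1)
      Nat.prime_two Nat.prime_three (by norm_num) (by norm_num) (by norm_num) hN4
      (by simpa using hN3)
    have := Nat.card_le_card_of_injective g hg
    rw [card_two_primes] at this
    omega
  by_cases h : ∃ N ∈ C, 2 ∣ N.index ∧ 3 ∣ N.index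
  · -- The siblings of `N` account for all components. The component `Λ` and its sibling on the
    -- second level at `2` both lie in the same sibling of `N` at `2`, so they coincide.
    obtain ⟨N, hN, hN2, hN3⟩ := h
    obtain ⟨v, w, hw, hv, g, hg, h0, hl, hr⟩ := hC.exists_siblings_two_primes hfin hN (a := 1)
      (b := 1) Nat.prime_two Nat.prime_three (by norm_num) (by norm_num) (by norm_num)
      (by simpa using hN2) (by simpa using hN3)
    have hbij : Function.Bijective g :=
      hg.bijective_of_nat_card_le (by rw [card_two_primes, hcard])
    have hNv : N ≤ slopeLattice 2 v := by
      conv_lhs => rw [hv.eq_slopeLattice]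
      exact (slopeLattice_le_iff_dvd hv.isCoprime).2 hN2
    have hlev : ∀ x : SiblingIndex 2 1, x.level = 0 := fun x => by
      have := x.level_lt one_ne_zero; omega
    have hl' : ∀ x, (g (some (.inl x)) : AddSubgroup (Fin 2 → ℤ)) ≤ slopeLattice 2 (x.vec v w) :=
      fun x => by simpa [hlev x] using hl x
    obtain ⟨s, hs⟩ := hC.exists_isPrivateVector hΛ
    obtain ⟨t, ht⟩ := exists_det2_eq_one hs.isCoprime
    -- the sibling of `Λ` at `2` on the second level
    let y : SiblingIndex 2 2 := some (1, 0)
    obtain ⟨K, hK, hKy, -⟩ := hC.exists_le_of_sibling hfin hs (j := 1) Nat.prime_two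
      h4 (y.isCoprime_vec ht) (y.pow_level_dvd ht)
    have hΛs : Λ ≤ slopeLattice (2 ^ 2) s := by
      conv_lhs => rw [hs.eq_slopeLattice]
      exact (slopeLattice_le_iff_dvd hs.isCoprime).2 h4
    have hKs : K ≤ slopeLattice 2 s := by
      refine hKy.trans ((y.isCoprime_vec ht).unimodularMod _ |>.slopeLattice_le ?_ (by norm_num))
      simpa [mem_slopeLattice, y, SiblingIndex.level] using y.pow_level_dvd ht
    have hKΛ : K ≠ Λ := fun he =>
      hC.not_le_sibling hΛ ht Nat.prime_two (x := y) (by decide) hΛs (he ▸ hKy)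
    have hK2 : 2 ∣ K.index := by
      have := AddSubgroup.index_dvd_of_le hKs
      rwa [index_slopeLattice hs.isCoprime] at this
    have hΛ3 : ¬ 3 ∣ Λ.index := h12 Λ hΛ h4
    obtain ⟨x, hx⟩ := hbij.2 ⟨Λ, hΛ⟩
    have hx : (g x : AddSubgroup (Fin 2 → ℤ)) = Λ := congrArg Subtype.val hx
    obtain ⟨x', hx'⟩ := hbij.2 ⟨K, hK⟩
    have hx' : (g x' : AddSubgroup (Fin 2 → ℤ)) = K := congrArg Subtype.val hx'
    -- `Λ` lies in a sibling of `N` at `2`.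
    obtain ⟨x, rfl⟩ : ∃ z, x = some (.inl z) := by
      rcases x with _ | x | x
      · exact absurd (by rw [← hx, h0]; exact hN3) hΛ3
      · exact ⟨x, rfl⟩
      · refine absurd ?_ hΛ3
        have := AddSubgroup.index_dvd_of_le (hr x).1
        rw [index_slopeLattice (x.isCoprime_vec hw), hx] at this
        exact (dvd_pow_self 3 (Nat.succ_ne_zero _)).trans this
    have hsx : (2 : ℤ) ∣ det2 s (x.vec v w) :=
      dvd_det2_of_le hs.isCoprime hs.mem hΛs (hx ▸ hl' x) (by norm_num) (by norm_num)
    have hKx : K ≤ slopeLattice 2 (x.vec v w) := fun z hz =>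
      (hs.isCoprime.unimodularMod _).dvd_det2 hsx (hKs hz)
    -- `K` lies in the same sibling, hence in no other member of the list.
    have hKv : ¬ K ≤ slopeLattice 2 v := fun hle =>
      hC.not_le_sibling hK hw Nat.prime_two (x := x) (n := 1) (by simp [hlev])
        (by simpa using hle) (by simpa [hlev] using hKx)
    obtain ⟨x', rfl⟩ : ∃ z, x' = some (.inl z) := by
      rcases x' with _ | x' | x'
      · exact absurd (by rw [← hx', h0]; exact hNv) hKv
      · exact ⟨x', rfl⟩
      · exact absurd (hx' ▸ (hr x').2 (hx'.symm ▸ hK2)) hKv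
    have : x = x' := hC.sibling_eq hK hw Nat.prime_two (by simpa [hlev] using hKx)
      (by simpa [hlev, hx'] using hl' x')
    exact hKΛ (by rw [← hx, ← hx', this])
  · -- No index is divisible by `6`: combine the `2`-part of a private vector of `M` with the
    -- `3`-part of a private vector of `Λ`. The coefficient `9` is `1` modulo `8` and `0` modulo `3`,
    -- and `16` the other way round.
    push Not at h
    obtain ⟨u, hu⟩ := hC.exists_isPrivateVector hΛ
    obtain ⟨v, hv⟩ := hC.exists_isPrivateVector hM
    obtain ⟨N, hN, hzN⟩ := hC.cover ((9 : ℤ) • v + (16 : ℤ) • u)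
    obtain ⟨t, ht⟩ := hC.exists_isPrivateVector hN
    rw [ht.eq_slopeLattice, mem_slopeLattice, det2_add, det2_smul, det2_smul] at hzN
    have hN8 : N.index ∣ 8 ∨ N.index ∣ 3 := by
      have h1 := h N hN
      have h2 := h24 N hN
      have : N.index ∈ Nat.divisors 24 := by simp [h2]
      generalize N.index = n at *
      fin_cases this <;> simp_all
    rcases hN8 with hN8 | hN3
    · have hvN : v ∈ N := by
        rw [ht.eq_slopeLattice, mem_slopeLattice]
        have h8 : (N.index : ℤ) ∣ 8 := by exact_mod_cast Int.natCast_dvd_natCast.2 hN8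
        have e : det2 t v = 9 * det2 t v + 16 * det2 t u - 8 * (det2 t v + 2 * det2 t u) := by ring
        rw [e]
        exact dvd_sub hzN (h8.mul_right _)
      rw [← hv.eq N hN hvN] at h3
      have := h3.trans hN8
      omega
    · have huN : u ∈ N := by
        rw [ht.eq_slopeLattice, mem_slopeLattice]
        have h3 : (N.index : ℤ) ∣ 3 := by exact_mod_cast Int.natCast_dvd_natCast.2 hN3
        have e : det2 t u = 9 * det2 t v + 16 * det2 t u - 3 * (3 * det2 t v + 5 * det2 t u) := by
          ring
        rw [e]
        exact dvd_sub hzN (h3.mul_right _)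
      rw [← hu.eq N hN huN] at h4
      have := h4.trans hN3
      omega

/-- All indices of a minimal covering of length six divide one of `5`, `6`, `9` and `16`. -/
lemma index_dvd (hC : IsMinimalCover C) (h6 : C.ncard = 6) :
    ∃ N ∈ [5, 6, 9, 16], ∀ M ∈ C, M.index ∣ N := by
  have hfin : C.Finite := Set.finite_of_ncard_ne_zero (by omega)
  -- the tight cases of the bound
  have tight : ∀ p a, p.Prime → a ≠ 0 → a * (p - 1) + 2 = 6 → (∃ M ∈ C, p ^ a ∣ M.index) →
      ∀ M ∈ C, M.index ∣ p ^ a := by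
    rintro p a hp ha h ⟨M, hM, hd⟩
    exact (hC.prime_pow_bound hfin hM hp ha hd).2 (by omega)
  by_cases h5 : ∃ M ∈ C, 5 ^ 1 ∣ M.index
  · exact ⟨5, by simp, by simpa using tight 5 1 (by norm_num) (by norm_num) (by norm_num) h5⟩
  by_cases h9 : ∃ M ∈ C, 3 ^ 2 ∣ M.index
  · exact ⟨9, by simp, by simpa using tight 3 2 (by norm_num) (by norm_num) (by norm_num) h9⟩
  by_cases h16 : ∃ M ∈ C, 2 ^ 4 ∣ M.index
  · exact ⟨16, by simp, by simpa using tight 2 4 (by norm_num) (by norm_num) (by norm_num) h16⟩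
  push Not at h5 h9 h16
  have h24 : ∀ M ∈ C, M.index ∣ 24 := by
    intro M hM
    refine (Nat.dvd_iff_prime_pow_dvd_dvd 24 M.index).2 fun p k hp hd => ?_
    rcases Nat.eq_zero_or_pos k with rfl | hk
    · simp
    have hb := (hC.prime_pow_bound hfin hM hp hk.ne' hd).1
    rw [h6] at hb
    have hp6 : p ≤ 5 := by
      have : p - 1 ≤ k * (p - 1) := Nat.le_mul_of_pos_left _ hk
      omega
    have hp2 := hp.two_le
    interval_cases p
    · have : k < 4 := by
        by_contra! hk4
        exact h16 M hM ((pow_dvd_pow 2 hk4).trans hd)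
      exact (pow_dvd_pow 2 (by omega : k ≤ 3)).trans (by norm_num)
    · have : k < 2 := by
        by_contra! hk2
        exact h9 M hM ((pow_dvd_pow 3 hk2).trans hd)
      exact (pow_dvd_pow 3 (by omega : k ≤ 1)).trans (by norm_num)
    · norm_num at hp
    · exact absurd ((pow_dvd_pow 5 hk).trans hd) (h5 M hM)
  by_cases h3 : ∃ M ∈ C, 3 ∣ M.index
  · obtain ⟨M, hM, hM3⟩ := h3
    refine ⟨6, by simp, fun N hN => ?_⟩
    have hN4 : ¬ 4 ∣ N.index := fun hN4 => hC.not_four_dvd_and_three_dvd h6 h24 hN hN4 hM hM3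
    have : N.index ∈ Nat.divisors 24 := by simp [h24 N hN]
    generalize N.index = n at *
    fin_cases this <;> simp_all
  · push Not at h3
    refine ⟨16, by simp, fun N hN => ?_⟩
    have hN3 := h3 N hN
    have : N.index ∈ Nat.divisors 24 := by simp [h24 N hN]
    generalize N.index = n at *
    fin_cases this <;> simp_all

end IsMinimalCover

/-! ### Encoding of lattices and reduction to finitely many points -/

/-- The triple `(n, a, b)` encodes the lattice `slopeLattice n (a, b)`. -/
abbrev LatticeCode : Type := ℕ × ℕ × ℕ

/-- A pair of natural numbers as a vector of `ℤ²`. -/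
def toVec (x : ℕ × ℕ) : Fin 2 → ℤ := ![x.1, x.2]

namespace LatticeCode

/-- The lattice encoded by a triple. -/
def lattice (c : LatticeCode) : AddSubgroup (Fin 2 → ℤ) := slopeLattice c.1 (toVec c.2)

/-- The boolean test of membership in the encoded lattice, written with the operations of `ℕ` that
the kernel evaluates on binary literals. -/
def contains (c : LatticeCode) (y : ℕ × ℕ) : Bool :=
  Nat.beq (Nat.mod (Nat.mul c.2.1 y.2) c.1) (Nat.mod (Nat.mul c.2.2 y.1) c.1)

/-- The boolean test for two codes to encode the same lattice. -/
def same (c d : LatticeCode) : Bool := Nat.beq c.1 d.1 && c.contains d.2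

/-- Validity of a code at level `N`: it encodes a proper lattice, generated by a primitive vector
and `n ℤ²` for a divisor `n` of `N`. -/
def IsValid (N : ℕ) (c : LatticeCode) : Prop :=
  2 ≤ c.1 ∧ c.1 ∣ N ∧ c.2.1.Coprime c.2.2

instance (N : ℕ) (c : LatticeCode) : Decidable (c.IsValid N) :=
  inferInstanceAs (Decidable (_ ∧ _ ∧ _))

lemma contains_iff {c : LatticeCode} {y : ℕ × ℕ} :
    c.contains y = true ↔ toVec y ∈ c.lattice := by
  rw [contains, Nat.beq_eq]
  rw [eq_comm]
  change (c.2.2 * y.1 ≡ c.2.1 * y.2 [MOD c.1]) ↔ _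
  rw [Nat.modEq_iff_dvd]
  simp [lattice, mem_slopeLattice, det2, toVec]

end LatticeCode

lemma isCoprime_toVec {x : ℕ × ℕ} (h : x.1.Coprime x.2) : IsCoprime (toVec x 0) (toVec x 1) := by
  simpa [toVec] using Nat.isCoprime_iff_coprime.2 h

namespace LatticeCode

variable {N : ℕ} {c d : LatticeCode}

lemma IsValid.isCoprime (h : c.IsValid N) : IsCoprime (toVec c.2 0) (toVec c.2 1) :=
  isCoprime_toVec h.2.2

lemma IsValid.index_lattice (h : c.IsValid N) : c.lattice.index = c.1 :=
  index_slopeLattice h.isCoprime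

lemma same_iff {N M : ℕ} (hc : c.IsValid N) (hd : d.IsValid M) :
    c.same d = true ↔ c.lattice = d.lattice := by
  rw [same, Bool.and_eq_true, Nat.beq_eq, contains_iff]
  constructor
  · rintro ⟨h, hm⟩
    rw [lattice, slopeLattice_eq (hc.isCoprime.unimodularMod _) (hd.isCoprime.unimodularMod _) hm,
      h, lattice]
  · intro h
    refine ⟨by rw [← hc.index_lattice, h, hd.index_lattice], ?_⟩
    rw [h]
    exact self_mem_slopeLattice _ _

end LatticeCode

/-- Membership of a primitive vector in a lattice of index dividing `N` depends only on the class
of the vector in the projective line over `ℤ / N`. -/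
lemma mem_iff_mem_of_mem_slopeLattice {Λ : AddSubgroup (Fin 2 → ℤ)} {N : ℕ} {u v : Fin 2 → ℤ}
    (hN : Λ.index ∣ N) (hu : IsCoprime (u 0) (u 1)) (hv : IsCoprime (v 0) (v 1))
    (h : v ∈ slopeLattice N u) : u ∈ Λ ↔ v ∈ Λ := by
  have hN' : (Λ.index : ℤ) ∣ N := Int.natCast_dvd_natCast.2 hN
  constructor
  · intro hm
    rw [eq_slopeLattice hu hm]
    exact hN'.trans h
  · intro hm
    rw [eq_slopeLattice hv hm]
    exact hN'.trans (mem_slopeLattice_comm.1 h)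

/-- A list of primitive vectors that represents every class of the projective line over
`ℤ / N`. -/
structure IsPointSystem (N : ℕ) (P : List (ℕ × ℕ)) : Prop where
  coprime : ∀ x ∈ P, x.1.Coprime x.2
  exists_mem : ∀ u : Fin 2 → ℤ, IsCoprime (u 0) (u 1) → ∃ x ∈ P, toVec x ∈ slopeLattice N u

lemma isPointSystem_of_forall {N : ℕ} {P : List (ℕ × ℕ)} (hN : N ≠ 0)
    (hP : ∀ x ∈ P, Nat.gcd x.1 x.2 = 1)
    (h : ∀ a < N, ∀ b < N, Nat.gcd (Nat.gcd a b) N = 1 →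
      P.any (LatticeCode.contains (N, a, b)) = true) : IsPointSystem N P := by
  refine ⟨hP, fun u hu => ?_⟩
  have hN' : (N : ℤ) ≠ 0 := by exact_mod_cast hN
  obtain ⟨a, ha⟩ := Int.eq_ofNat_of_zero_le (Int.emod_nonneg (u 0) hN')
  obtain ⟨b, hb⟩ := Int.eq_ofNat_of_zero_le (Int.emod_nonneg (u 1) hN')
  have hlt : ∀ z : ℤ, z % N < N := fun z => Int.emod_lt_of_pos _ (by omega)
  have haN : a < N := by have := hlt (u 0); omega
  have hbN : b < N := by have := hlt (u 1); omega
  have ha' : (N : ℤ) ∣ u 0 - a := ha ▸ Int.dvd_self_sub_emod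
  have hb' : (N : ℤ) ∣ u 1 - b := hb ▸ Int.dvd_self_sub_emod
  obtain ⟨s, t, hst⟩ := hu
  have hgcd : Nat.gcd (Nat.gcd a b) N = 1 := by
    set g := Nat.gcd (Nat.gcd a b) N with hg
    have hgN : (g : ℤ) ∣ N := Int.natCast_dvd_natCast.2 (Nat.gcd_dvd_right _ _)
    have hga : (g : ℤ) ∣ a :=
      Int.natCast_dvd_natCast.2 ((Nat.gcd_dvd_left _ _).trans (Nat.gcd_dvd_left _ _))
    have hgb : (g : ℤ) ∣ b :=
      Int.natCast_dvd_natCast.2 ((Nat.gcd_dvd_left _ _).trans (Nat.gcd_dvd_right _ _))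
    have h0 : (g : ℤ) ∣ u 0 := by simpa using dvd_add (hgN.trans ha') hga
    have h1 : (g : ℤ) ∣ u 1 := by simpa using dvd_add (hgN.trans hb') hgb
    have : (g : ℤ) ∣ 1 := hst ▸ dvd_add (h0.mul_left s) (h1.mul_left t)
    exact_mod_cast Int.eq_one_of_dvd_one (by positivity) this
  obtain ⟨x, hx, hxc⟩ := List.any_eq_true.1 (h a haN b hbN hgcd)
  refine ⟨x, hx, ?_⟩
  have hd : (N : ℤ) ∣ det2 (toVec (a, b)) (toVec x) := LatticeCode.contains_iff.1 hxc
  rw [mem_slopeLattice]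
  have e : det2 u (toVec x) = det2 (toVec (a, b)) (toVec x) + (u 0 - a) * toVec x 1 -
      (u 1 - b) * toVec x 0 := by
    simp only [det2, toVec]; simp; ring
  rw [e]
  exact dvd_sub (dvd_add hd (ha'.mul_right _)) (hb'.mul_right _)

/-! ### A decidable criterion for minimality -/

/-- The set of lattices encoded by a list of codes. -/
def coverOf (row : List LatticeCode) : Set (AddSubgroup (Fin 2 → ℤ)) :=
  {Λ | Λ ∈ row.map LatticeCode.lattice}

/-- The divisors of `N` that are at least `2`. -/
def properDivisors (N : ℕ) : List ℕ :=
  (List.range (N + 1)).filter fun d => Nat.ble 2 d && Nat.beq (Nat.mod N d) 0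

/-- The points of `P` that `c` contains and that no other lattice of `row` contains. -/
def privatePoints (P : List (ℕ × ℕ)) (row : List LatticeCode) (c : LatticeCode) :
    List (ℕ × ℕ) :=
  P.filter fun x => c.contains x && row.all fun d => c.same d || !d.contains x

/-- The test that `c` is generated by its private vectors: it has some private point `r`, and
every `d` for which all private points are proportional to `r` modulo `d` divides the index. -/
def isTight (D : List ℕ) (P : List (ℕ × ℕ)) (row : List LatticeCode) (c : LatticeCode) : Bool :=
  match privatePoints P row c with
  | [] => false
  | r :: R => D.all fun d => Nat.beq (Nat.mod c.1 d) 0 || !R.all (LatticeCode.contains (d, r))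

/-- The test that every point of `P` lies in one of the lattices of `row`. -/
def coversPoints (P : List (ℕ × ℕ)) (row : List LatticeCode) : Bool :=
  P.all fun x => row.any fun c => c.contains x

lemma mem_properDivisors {N d : ℕ} (hN : N ≠ 0) : d ∈ properDivisors N ↔ 2 ≤ d ∧ d ∣ N := by
  rw [properDivisors, List.mem_filter, Bool.and_eq_true, Nat.ble_eq, Nat.beq_eq,
    List.mem_range]
  change _ ∧ _ ∧ N % d = 0 ↔ _
  rw [← Nat.dvd_iff_mod_eq_zero]
  exact ⟨fun h => h.2, fun h => ⟨Nat.lt_succ_of_le (Nat.le_of_dvd (Nat.pos_of_ne_zero hN) h.2), h⟩⟩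

lemma mem_coverOf {row : List LatticeCode} {Λ : AddSubgroup (Fin 2 → ℤ)} :
    Λ ∈ coverOf row ↔ ∃ c ∈ row, c.lattice = Λ := List.mem_map

section

variable {N : ℕ} {P : List (ℕ × ℕ)} {row : List LatticeCode} {c : LatticeCode}

lemma index_dvd_of_mem_coverOf (hrow : ∀ c ∈ row, c.IsValid N) {M : AddSubgroup (Fin 2 → ℤ)}
    (hM : M ∈ coverOf row) : M.index ∣ N := by
  obtain ⟨d, hd, rfl⟩ := mem_coverOf.1 hM
  rw [(hrow d hd).index_lattice]
  exact (hrow d hd).2.1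

lemma mem_privatePoints (hrow : ∀ c ∈ row, c.IsValid N) (hc : c ∈ row) {x : ℕ × ℕ} :
    x ∈ privatePoints P row c ↔
      x ∈ P ∧ toVec x ∈ c.lattice ∧ ∀ M ∈ coverOf row, toVec x ∈ M → M = c.lattice := by
  rw [privatePoints, List.mem_filter, Bool.and_eq_true, LatticeCode.contains_iff,
    List.all_eq_true]
  refine and_congr_right fun _ => and_congr_right fun _ => ⟨fun h M hM hx => ?_, fun h d hd => ?_⟩
  · obtain ⟨d, hd, rfl⟩ := mem_coverOf.1 hM
    have := h d hd
    rw [Bool.or_eq_true, LatticeCode.same_iff (hrow c hc) (hrow d hd)] at this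
    rcases this with h | h
    · exact h.symm
    · rw [LatticeCode.contains_iff.2 hx] at h
      simp at h
  · rw [Bool.or_eq_true, LatticeCode.same_iff (hrow c hc) (hrow d hd)]
    by_cases hx : d.contains x = true
    · exact .inl (h _ (mem_coverOf.2 ⟨d, hd, rfl⟩) (LatticeCode.contains_iff.1 hx)).symm
    · exact .inr (by simpa using hx)

/-- The tests are sound: a list that passes them encodes a minimal covering. -/
lemma isMinimalCover_coverOf (hN : N ≠ 0) (hP : IsPointSystem N P)
    (hrow : ∀ c ∈ row, c.IsValid N) (hcov : coversPoints P row = true)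
    (htight : ∀ c ∈ row, isTight (properDivisors N) P row c = true) :
    IsMinimalCover (coverOf row) := by
  have hdvd := fun M hM => index_dvd_of_mem_coverOf hrow (M := M) hM
  refine ⟨fun M hM => ne_zero_of_dvd_ne_zero hN (hdvd M hM), fun v => ?_, fun Λ hΛ Λ' hlt h0 => ?_⟩
  · obtain ⟨k, w, hw, rfl⟩ := exists_eq_smul_isCoprime v
    obtain ⟨x, hx, hxw⟩ := hP.exists_mem w hw
    obtain ⟨c, hc, hcx⟩ := List.any_eq_true.1 (List.all_eq_true.1 hcov x hx)
    have hM : c.lattice ∈ coverOf row := mem_coverOf.2 ⟨c, hc, rfl⟩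
    exact ⟨_, hM, AddSubgroup.zsmul_mem _ ((mem_iff_mem_of_mem_slopeLattice (hdvd _ hM) hw
      (isCoprime_toVec (hP.coprime x hx)) hxw).2 (LatticeCode.contains_iff.1 hcx)) k⟩
  · obtain ⟨c, hc, rfl⟩ := mem_coverOf.1 hΛ
    by_contra! hcon
    have ht := htight c hc
    rw [isTight] at ht
    split at ht
    · simp at ht
    · rename_i r R hrR
      have hpriv : ∀ x ∈ r :: R, x ∈ P ∧ toVec x ∈ c.lattice ∧
          ∀ M ∈ coverOf row, toVec x ∈ M → M = c.lattice := fun x hx =>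
        (mem_privatePoints hrow hc).1 (hrR ▸ hx)
      -- The whole class of a private point modulo `N` lies in `Λ'`.
      have hclass : ∀ x ∈ r :: R, ∀ z : Fin 2 → ℤ, toVec x + (N : ℤ) • z ∈ Λ' := by
        intro x hx z
        by_contra hnot
        obtain ⟨M, hM, hmem, hne⟩ := hcon _ hnot
        refine hne ((hpriv x hx).2.2 M hM ?_)
        obtain ⟨d, hd, rfl⟩ := mem_coverOf.1 hM
        rw [LatticeCode.lattice, mem_slopeLattice, det2_add, det2_smul] at hmem
        exact (dvd_add_left ((Int.natCast_dvd_natCast.2 (hrow d hd).2.1).mul_right _)).1 hmem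
      have hmemΛ' : ∀ x ∈ r :: R, toVec x ∈ Λ' := fun x hx => by simpa using hclass x hx 0
      have hr : r ∈ r :: R := List.mem_cons_self
      have hrc := isCoprime_toVec (hP.coprime r (hpriv r hr).1)
      have hΛ' := eq_slopeLattice hrc (hmemΛ' r hr)
      obtain ⟨z, hz⟩ := exists_det2_eq_one hrc
      have hNz := Λ'.sub_mem (hclass r hr z) (hmemΛ' r hr)
      rw [add_sub_cancel_left, hΛ', mem_slopeLattice, det2_smul, hz, mul_one] at hNz
      have h1 : Λ'.index ≠ 1 := fun h1 => by
        rw [AddSubgroup.index_eq_one] at h1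
        exact not_top_lt (h1 ▸ hlt)
      have := List.all_eq_true.1 ht Λ'.index
        ((mem_properDivisors hN).2 ⟨by omega, Int.natCast_dvd_natCast.1 hNz⟩)
      rw [Bool.or_eq_true] at this
      rcases this with h | h
      · have hd : Λ'.index ∣ c.1 := Nat.dvd_of_mod_eq_zero (Nat.eq_of_beq_eq_true h)
        have hΛr : c.lattice = slopeLattice c.1 (toVec r) := by
          conv_lhs => rw [eq_slopeLattice hrc (hpriv r hr).2.1, (hrow c hc).index_lattice]
        refine hlt.not_ge ?_
        rw [hΛr, hΛ']
        exact (slopeLattice_le_iff_dvd hrc).2 hd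
      · rw [Bool.not_eq_true', List.all_eq_false] at h
        obtain ⟨x, hx, hnx⟩ := h
        refine hnx (LatticeCode.contains_iff.2 ?_)
        have := hmemΛ' x (List.mem_cons_of_mem _ hx)
        rw [hΛ'] at this
        exact this

/-- The tests are complete: a list that encodes a minimal covering passes them. -/
lemma isTight_of_isMinimalCover (hN : N ≠ 0) (hP : IsPointSystem N P)
    (hrow : ∀ c ∈ row, c.IsValid N) (hC : IsMinimalCover (coverOf row)) (hc : c ∈ row) :
    isTight (properDivisors N) P row c = true := by
  have hdvd := fun M hM => index_dvd_of_mem_coverOf hrow (M := M) hM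
  have hΛ : c.lattice ∈ coverOf row := mem_coverOf.2 ⟨c, hc, rfl⟩
  -- A primitive vector that lies in no other component is represented by a private point.
  have hrep : ∀ w : Fin 2 → ℤ, IsCoprime (w 0) (w 1) →
      (∀ M ∈ coverOf row, w ∈ M → M = c.lattice) →
      ∃ x ∈ privatePoints P row c, toVec x ∈ slopeLattice N w := by
    intro w hw hwp
    obtain ⟨x, hx, hxw⟩ := hP.exists_mem w hw
    have hiff := fun M hM => mem_iff_mem_of_mem_slopeLattice (hdvd M hM) hw
      (isCoprime_toVec (hP.coprime x hx)) hxw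
    obtain ⟨M, hM, hwM⟩ := hC.cover w
    exact ⟨x, (mem_privatePoints hrow hc).2 ⟨hx, (hiff _ hΛ).1 (hwp M hM hwM ▸ hwM),
      fun K hK hxK => hwp K hK ((hiff K hK).2 hxK)⟩, hxw⟩
  rw [isTight]
  split
  · rename_i hnil
    obtain ⟨v, hv⟩ := hC.exists_isPrivateVector hΛ
    obtain ⟨x, hx, -⟩ := hrep v hv.isCoprime hv.eq
    rw [hnil] at hx
    simp at hx
  · rename_i r R hrR
    refine List.all_eq_true.2 fun d hd => ?_
    obtain ⟨hd2, hdN⟩ := (mem_properDivisors hN).1 hd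
    by_contra hcon
    rw [Bool.or_eq_true, not_or] at hcon
    have hall : ∀ x ∈ R, toVec x ∈ slopeLattice d (toVec r) := fun x hx =>
      LatticeCode.contains_iff (c := (d, r)).1 (by
        have := hcon.2
        rw [Bool.not_eq_true', Bool.not_eq_false, List.all_eq_true] at this
        exact this x hx)
    have hnd : ¬ d ∣ c.1 := fun h => hcon.1 <| by
      rw [Nat.beq_eq]
      exact Nat.mod_eq_zero_of_dvd h
    have hr := (mem_privatePoints (P := P) hrow hc).1 (hrR ▸ List.mem_cons_self)
    have hrc := isCoprime_toVec (hP.coprime r hr.1)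
    have hΛr : c.lattice = slopeLattice c.1 (toVec r) := by
      conv_lhs => rw [eq_slopeLattice hrc hr.2.1, (hrow c hc).index_lattice]
    -- The private vectors lie in the lattice of index `lcm c.1 d`, which is smaller than `c`.
    have hlN : Nat.lcm c.1 d ∣ N := Nat.lcm_dvd (hrow c hc).2.1 hdN
    have hlt : slopeLattice (Nat.lcm c.1 d) (toVec r) < c.lattice := by
      rw [hΛr]
      refine lt_of_le_of_ne ((slopeLattice_le_iff_dvd hrc).2 (Nat.dvd_lcm_left _ _)) fun he => ?_
      exact hnd ((Nat.dvd_lcm_right _ _).trans ((slopeLattice_le_iff_dvd hrc).1 he.ge))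
    obtain ⟨v, hv, hvp⟩ := hC.minimal _ hΛ _ hlt (by
      rw [index_slopeLattice hrc]
      exact ne_zero_of_dvd_ne_zero hN hlN)
    obtain ⟨k, w, hw, rfl⟩ := exists_eq_smul_isCoprime v
    obtain ⟨x, hx, hxw⟩ := hrep w hw fun M hM hwM => hvp M hM (M.zsmul_mem hwM k)
    refine hv (AddSubgroup.zsmul_mem _ ?_ k)
    have hx' := (mem_privatePoints hrow hc).1 hx
    refine (mem_iff_mem_of_mem_slopeLattice (by rwa [index_slopeLattice hrc]) hw
      (isCoprime_toVec (hP.coprime x hx'.1)) hxw).2 ?_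
    have h1 : ((c.1 : ℕ) : ℤ) ∣ det2 (toVec r) (toVec x) := by
      have := hx'.2.1
      rwa [hΛr] at this
    have h2 : (d : ℤ) ∣ det2 (toVec r) (toVec x) := by
      rw [hrR] at hx
      rcases List.mem_cons.1 hx with rfl | hx
      · simp [det2_self]
      · exact hall x hx
    exact Int.natCast_dvd.2 (Nat.lcm_dvd (Int.natCast_dvd.1 h1) (Int.natCast_dvd.1 h2))

end

/-! ### Exhaustive search -/

/-- The search for coverings by `r` further lattices of the points `U` not yet covered by the
lattices `ch`. A lattice through the first uncovered point `x` is `slopeLattice n x` for some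
`n` in `D`. The result is the conjunction of `leaf row` over all coverings `row` found. -/
def search (leaf : List LatticeCode → Bool) (D : List ℕ) :
    ℕ → List (ℕ × ℕ) → List LatticeCode → Bool
  | 0, [], ch => leaf ch
  | 0, _ :: _, _ => true
  | _ + 1, [], _ => true
  | r + 1, x :: U, ch =>
    D.all fun n => search leaf D r (U.filter fun y => !LatticeCode.contains (n, x) y) ((n, x) :: ch)

lemma ncard_setOf_mem {α : Type*} {l : List α} (h : l.Nodup) : {x | x ∈ l}.ncard = l.length := by
  classical
  rw [← List.toFinset_card_of_nodup h, ← Set.ncard_coe_finset]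
  congr 1
  ext x
  simp

lemma exists_of_search {N : ℕ} {P : List (ℕ × ℕ)} (hN : N ≠ 0) (hP : IsPointSystem N P)
    {C : Set (AddSubgroup (Fin 2 → ℤ))} (hC : IsMinimalCover C) (h2 : 2 ≤ C.ncard)
    (hdvd : ∀ M ∈ C, M.index ∣ N) (leaf : List LatticeCode → Bool) (r : ℕ) (U : List (ℕ × ℕ))
    (ch : List LatticeCode) (hch : ∀ c ∈ ch, c.IsValid N) (hsub : coverOf ch ⊆ C)
    (hnodup : (ch.map LatticeCode.lattice).Nodup) (hcard : r + ch.length = C.ncard)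
    (hU : ∀ x, x ∈ U ↔ x ∈ P ∧ ∀ c ∈ ch, ¬ c.contains x = true)
    (hs : search leaf (properDivisors N) r U ch = true) :
    ∃ row : List LatticeCode, (∀ c ∈ row, c.IsValid N) ∧ coverOf row = C ∧ leaf row = true := by
  have hfin : C.Finite := Set.finite_of_ncard_ne_zero (by omega)
  have hncard : (coverOf ch).ncard = ch.length := by
    rw [coverOf, ncard_setOf_mem hnodup, List.length_map]
  induction r generalizing U ch with
  | zero =>
    have heq : coverOf ch = C := Set.eq_of_subset_of_ncard_le hsub (by omega) hfin
    cases U with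
    | nil => exact ⟨ch, hch, heq, hs⟩
    | cons x U =>
      obtain ⟨hx, hxc⟩ := (hU x).1 List.mem_cons_self
      obtain ⟨M, hM, hxM⟩ := hC.cover (toVec x)
      obtain ⟨c, hc, rfl⟩ := mem_coverOf.1 (heq ▸ hM)
      exact absurd (LatticeCode.contains_iff.2 hxM) (hxc c hc)
  | succ r ih =>
    cases U with
    | nil =>
      -- a component that is not chosen yet has a private vector
      obtain ⟨M, hM, hMch⟩ : ∃ M ∈ C, M ∉ coverOf ch := by
        by_contra! hcon
        rw [Set.Subset.antisymm hsub hcon] at hncard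
        omega
      obtain ⟨v, hv⟩ := hC.exists_isPrivateVector hM
      obtain ⟨x, hx, hxv⟩ := hP.exists_mem v hv.isCoprime
      have hxU := (hU x).not.1 List.not_mem_nil
      push Not at hxU
      obtain ⟨c, hc, hcx⟩ := hxU hx
      have hcC : c.lattice ∈ coverOf ch := mem_coverOf.2 ⟨c, hc, rfl⟩
      have hvc := (mem_iff_mem_of_mem_slopeLattice (hdvd _ (hsub hcC)) hv.isCoprime
        (isCoprime_toVec (hP.coprime x hx)) hxv).2 (LatticeCode.contains_iff.1 hcx)
      exact absurd (hv.eq _ (hsub hcC) hvc ▸ hcC) hMch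
    | cons x U =>
      obtain ⟨hx, hxc⟩ := (hU x).1 List.mem_cons_self
      have hcop := hP.coprime x hx
      obtain ⟨M, hM, hxM⟩ := hC.cover (toVec x)
      have hMx := eq_slopeLattice (isCoprime_toVec hcop) hxM
      have hM2 : 2 ≤ M.index := by
        have := hC.index_ne_one h2 hM
        have := hC.index_ne_zero M hM
        omega
      have hs' := List.all_eq_true.1 hs M.index ((mem_properDivisors hN).2 ⟨hM2, hdvd M hM⟩)
      have hlat : LatticeCode.lattice (M.index, x) = M := hMx.symm
      have hMch : M ∉ coverOf ch := by
        intro hmem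
        obtain ⟨c, hc, rfl⟩ := mem_coverOf.1 hmem
        exact hxc c hc (LatticeCode.contains_iff.2 hxM)
      have hnodup' : (((M.index, x) :: ch).map LatticeCode.lattice).Nodup := by
        rw [List.map_cons, List.nodup_cons, hlat]
        exact ⟨hMch, hnodup⟩
      refine ih _ ((M.index, x) :: ch) ?_ ?_ hnodup' (by rw [List.length_cons]; omega) ?_ hs' ?_
      · intro c hc
        rcases List.mem_cons.1 hc with rfl | hc
        · exact ⟨hM2, hdvd M hM, hcop⟩
        · exact hch c hc
      · intro K hK
        obtain ⟨c, hc, rfl⟩ := mem_coverOf.1 hK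
        rcases List.mem_cons.1 hc with rfl | hc
        · rwa [hlat]
        · exact hsub (mem_coverOf.2 ⟨c, hc, rfl⟩)
      · intro y
        have hself : LatticeCode.contains (M.index, x) x = true :=
          LatticeCode.contains_iff.2 (by rwa [hlat])
        have hUy := hU y
        simp only [List.mem_cons] at hUy
        simp only [List.mem_filter, List.mem_cons, forall_eq_or_imp, Bool.not_eq_true',
          Bool.not_eq_true]
        constructor
        · rintro ⟨hy, hny⟩
          have := hUy.1 (.inr hy)
          exact ⟨this.1, hny, by simpa using this.2⟩
        · rintro ⟨hyP, hny, hyc⟩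
          rcases hUy.2 ⟨hyP, by simpa using hyc⟩ with rfl | hy
          · rw [hself] at hny
            simp at hny
          · exact ⟨hy, hny⟩
      · rw [coverOf, ncard_setOf_mem hnodup', List.length_map]

/-! ### The list of minimal coverings of length six -/

/-- Representatives of the projective line over `ℤ / N`, chosen greedily among primitive vectors
with small coordinates. -/
def points (N : ℕ) : List (ℕ × ℕ) :=
  (((List.range N).product (List.range (N + 1))).filter fun x => Nat.beq (Nat.gcd x.1 x.2) 1).foldr
    (fun x l => bif l.any (LatticeCode.contains (N, x)) then l else x :: l) []

/-- The boolean test for two lists of codes to encode the same set of lattices. -/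
def sameCover (r s : List LatticeCode) : Bool :=
  r.all (fun c => s.any c.same) && s.all fun c => r.any c.same

/-- The minimal coverings of length six. -/
def coverTable : List (List LatticeCode) := [
  [(2, 0, 1), (2, 1, 0), (4, 1, 1), (8, 1, 3), (16, 1, 7), (16, 1, 15)],
  [(2, 0, 1), (2, 1, 0), (4, 1, 1), (8, 1, 7), (16, 1, 3), (16, 1, 11)],
  [(2, 0, 1), (2, 1, 0), (4, 1, 3), (8, 1, 1), (16, 1, 5), (16, 1, 13)],
  [(2, 0, 1), (2, 1, 0), (4, 1, 3), (8, 1, 5), (16, 1, 1), (16, 1, 9)],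
  [(2, 0, 1), (2, 1, 0), (6, 1, 1), (6, 1, 3), (6, 1, 5), (6, 3, 1)],
  [(2, 0, 1), (2, 1, 0), (8, 1, 1), (8, 1, 3), (8, 1, 5), (8, 1, 7)],
  [(2, 0, 1), (2, 1, 1), (4, 1, 0), (8, 1, 2), (16, 1, 6), (16, 1, 14)],
  [(2, 0, 1), (2, 1, 1), (4, 1, 0), (8, 1, 6), (16, 1, 2), (16, 1, 10)],
  [(2, 0, 1), (2, 1, 1), (4, 1, 2), (8, 1, 0), (16, 1, 4), (16, 1, 12)],
  [(2, 0, 1), (2, 1, 1), (4, 1, 2), (8, 1, 4), (16, 1, 0), (16, 1, 8)],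
  [(2, 0, 1), (2, 1, 1), (6, 1, 0), (6, 1, 2), (6, 1, 4), (6, 3, 2)],
  [(2, 0, 1), (2, 1, 1), (8, 1, 0), (8, 1, 2), (8, 1, 4), (8, 1, 6)],
  [(2, 0, 1), (4, 1, 0), (4, 1, 1), (4, 1, 2), (8, 1, 3), (8, 1, 7)],
  [(2, 0, 1), (4, 1, 0), (4, 1, 1), (4, 1, 3), (8, 1, 2), (8, 1, 6)],
  [(2, 0, 1), (4, 1, 0), (4, 1, 2), (4, 1, 3), (8, 1, 1), (8, 1, 5)],
  [(2, 0, 1), (4, 1, 1), (4, 1, 2), (4, 1, 3), (8, 1, 0), (8, 1, 4)],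
  [(2, 1, 0), (2, 1, 1), (4, 0, 1), (8, 2, 1), (16, 2, 3), (16, 2, 7)],
  [(2, 1, 0), (2, 1, 1), (4, 0, 1), (8, 2, 3), (16, 2, 1), (16, 2, 5)],
  [(2, 1, 0), (2, 1, 1), (4, 2, 1), (8, 0, 1), (16, 4, 1), (16, 4, 3)],
  [(2, 1, 0), (2, 1, 1), (4, 2, 1), (8, 4, 1), (16, 0, 1), (16, 8, 1)],
  [(2, 1, 0), (2, 1, 1), (6, 0, 1), (6, 2, 1), (6, 2, 3), (6, 2, 5)],
  [(2, 1, 0), (2, 1, 1), (8, 0, 1), (8, 2, 1), (8, 2, 3), (8, 4, 1)],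
  [(2, 1, 0), (4, 0, 1), (4, 1, 1), (4, 1, 3), (8, 2, 1), (8, 2, 3)],
  [(2, 1, 0), (4, 0, 1), (4, 1, 1), (4, 2, 1), (8, 1, 3), (8, 1, 7)],
  [(2, 1, 0), (4, 0, 1), (4, 1, 3), (4, 2, 1), (8, 1, 1), (8, 1, 5)],
  [(2, 1, 0), (4, 1, 1), (4, 1, 3), (4, 2, 1), (8, 0, 1), (8, 4, 1)],
  [(2, 1, 1), (4, 0, 1), (4, 1, 0), (4, 1, 2), (8, 2, 1), (8, 2, 3)],
  [(2, 1, 1), (4, 0, 1), (4, 1, 0), (4, 2, 1), (8, 1, 2), (8, 1, 6)],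
  [(2, 1, 1), (4, 0, 1), (4, 1, 2), (4, 2, 1), (8, 1, 0), (8, 1, 4)],
  [(2, 1, 1), (4, 1, 0), (4, 1, 2), (4, 2, 1), (8, 0, 1), (8, 4, 1)],
  [(3, 0, 1), (3, 1, 0), (3, 1, 1), (6, 1, 2), (6, 1, 5), (6, 2, 1)],
  [(3, 0, 1), (3, 1, 0), (3, 1, 1), (9, 1, 2), (9, 1, 5), (9, 1, 8)],
  [(3, 0, 1), (3, 1, 0), (3, 1, 2), (6, 1, 1), (6, 1, 4), (6, 2, 5)],
  [(3, 0, 1), (3, 1, 0), (3, 1, 2), (9, 1, 1), (9, 1, 4), (9, 1, 7)],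
  [(3, 0, 1), (3, 1, 1), (3, 1, 2), (6, 1, 0), (6, 1, 3), (6, 2, 3)],
  [(3, 0, 1), (3, 1, 1), (3, 1, 2), (9, 1, 0), (9, 1, 3), (9, 1, 6)],
  [(3, 1, 0), (3, 1, 1), (3, 1, 2), (6, 0, 1), (6, 3, 1), (6, 3, 2)],
  [(3, 1, 0), (3, 1, 1), (3, 1, 2), (9, 0, 1), (9, 3, 1), (9, 3, 2)],
  [(4, 0, 1), (4, 1, 0), (4, 1, 1), (4, 1, 2), (4, 1, 3), (4, 2, 1)],
  [(5, 0, 1), (5, 1, 0), (5, 1, 1), (5, 1, 2), (5, 1, 3), (5, 1, 4)]]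

lemma isPointSystem_points : ∀ N ∈ [5, 6, 9, 16], IsPointSystem N (points N) := by
  have key : ∀ N ∈ [5, 6, 9, 16], N ≠ 0 ∧ (∀ x ∈ points N, Nat.gcd x.1 x.2 = 1) ∧
      ∀ a < N, ∀ b < N, Nat.gcd (Nat.gcd a b) N = 1 →
        (points N).any (LatticeCode.contains (N, a, b)) = true := by
    decide +kernel
  exact fun N hN => isPointSystem_of_forall (key N hN).1 (key N hN).2.1 (key N hN).2.2

/-- Every list found by the search encodes a set in the table, unless it fails the test of
minimality. -/
lemma search_points : ∀ N ∈ [5, 6, 9, 16], search (fun row =>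
    !row.all (isTight (properDivisors N) (points N) row) || coverTable.any (sameCover row))
      (properDivisors N) 6 (points N) [] = true := by
  decide +kernel

lemma coverTable_valid : ∀ row ∈ coverTable, row.length = 6 ∧
    row.Pairwise (fun c d => ¬ c.same d = true) ∧
    ∃ N ∈ [5, 6, 9, 16], (∀ c ∈ row, c.IsValid N) ∧ coversPoints (points N) row = true ∧
      ∀ c ∈ row, isTight (properDivisors N) (points N) row c = true := by
  decide +kernel

lemma coverTable_pairwise : coverTable.Pairwise fun r s => ¬ sameCover r s = true := by
  decide +kernel

lemma sameCover_iff {N M : ℕ} {r s : List LatticeCode} (hr : ∀ c ∈ r, c.IsValid N)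
    (hs : ∀ c ∈ s, c.IsValid M) : sameCover r s = true ↔ coverOf r = coverOf s := by
  rw [sameCover, Bool.and_eq_true, List.all_eq_true, List.all_eq_true, Set.Subset.antisymm_iff]
  have aux : ∀ {N M : ℕ} {r s : List LatticeCode}, (∀ c ∈ r, c.IsValid N) →
      (∀ c ∈ s, c.IsValid M) → ((∀ c ∈ r, s.any c.same = true) ↔ coverOf r ⊆ coverOf s) := by
    intro N M r s hr hs
    constructor
    · intro h Λ hΛ
      obtain ⟨c, hc, rfl⟩ := mem_coverOf.1 hΛ
      obtain ⟨d, hd, hcd⟩ := List.any_eq_true.1 (h c hc)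
      exact mem_coverOf.2 ⟨d, hd, ((LatticeCode.same_iff (hr c hc) (hs d hd)).1 hcd).symm⟩
    · intro h c hc
      obtain ⟨d, hd, hdc⟩ := mem_coverOf.1 (h (mem_coverOf.2 ⟨c, hc, rfl⟩))
      exact List.any_eq_true.2 ⟨d, hd, (LatticeCode.same_iff (hr c hc) (hs d hd)).2 hdc.symm⟩
  exact and_congr (aux hr hs) (aux hs hr)

/-- The table encodes exactly the minimal coverings of length six. -/
lemma minimalCoverings_six :
    minimalCoverings 6 = {C | C ∈ coverTable.map coverOf} := by
  ext C
  rw [mem_minimalCoverings_iff (by norm_num), Set.mem_ofPred_eq, List.mem_map]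
  constructor
  · rintro ⟨hC, h6⟩
    obtain ⟨N, hN, hdvd⟩ := hC.index_dvd h6
    have hN0 : N ≠ 0 := by rintro rfl; simp at hN
    have hP := isPointSystem_points N hN
    obtain ⟨row, hrow, rfl, hleaf⟩ := exists_of_search hN0 hP hC (by omega) hdvd _ 6 (points N) []
      (by simp) (by simp [coverOf]) (by simp) (by simp [h6]) (by simp) (search_points N hN)
    rw [Bool.or_eq_true, Bool.not_eq_true', List.all_eq_false] at hleaf
    rcases hleaf with ⟨c, hc, hnot⟩ | hleaf
    · exact absurd (isTight_of_isMinimalCover hN0 hP hrow hC hc) hnot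
    · obtain ⟨s, hs, hsame⟩ := List.any_eq_true.1 hleaf
      obtain ⟨-, -, M, -, hval, -⟩ := coverTable_valid s hs
      exact ⟨s, hs, ((sameCover_iff hrow hval).1 hsame).symm⟩
  · rintro ⟨row, hrow, rfl⟩
    obtain ⟨hlen, hpw, N, hN, hval, hcov, htight⟩ := coverTable_valid row hrow
    have hN0 : N ≠ 0 := by rintro rfl; simp at hN
    refine ⟨isMinimalCover_coverOf hN0 (isPointSystem_points N hN) hval hcov htight, ?_⟩
    rw [coverOf, ncard_setOf_mem, List.length_map, hlen]
    refine List.pairwise_map.2 (hpw.imp_of_mem fun hc hd hne heq => hne ?_)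
    exact (LatticeCode.same_iff (hval _ hc) (hval _ hd)).2 heq

lemma ncard_minimalCoverings_six : (minimalCoverings 6).ncard = 40 := by
  rw [minimalCoverings_six, ncard_setOf_mem, List.length_map]
  · rfl
  · refine List.pairwise_map.2 (coverTable_pairwise.imp_of_mem fun hr hs hne heq => hne ?_)
    obtain ⟨-, -, N, -, hr', -⟩ := coverTable_valid _ hr
    obtain ⟨-, -, M, -, hs', -⟩ := coverTable_valid _ hs
    exact (sameCover_iff hr' hs').2 heq

/-! ### The coverings `coveringFour` and `coveringFive` -/

lemma mem_latticeOf {a b c d : ℤ} {v : Fin 2 → ℤ} :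
    v ∈ latticeOf !![a, b; c, d] ↔ ∃ s t : ℤ, s * a + t * b = v 0 ∧ s * c + t * d = v 1 := by
  have h : Set.range (Matrix.col !![a, b; c, d]) = {![a, c], ![b, d]} := by
    ext x
    simp only [Set.mem_range, Fin.exists_fin_two, Set.mem_insert_iff, Set.mem_singleton_iff]
    have h0 : Matrix.col !![a, b; c, d] 0 = ![a, c] := by ext i; fin_cases i <;> rfl
    have h1 : Matrix.col !![a, b; c, d] 1 = ![b, d] := by ext i; fin_cases i <;> rfl
    rw [h0, h1, eq_comm, @eq_comm _ _ x]
  rw [latticeOf, h, AddSubgroup.mem_closure_pair]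
  refine exists_congr fun s => exists_congr fun t => ?_
  rw [funext_iff, Fin.forall_fin_two]
  simp

lemma latticeOf_one (n k : ℕ) : latticeOf !![1, 0; k, n] = LatticeCode.lattice (n, 1, k) := by
  ext v
  rw [mem_latticeOf, LatticeCode.lattice, mem_slopeLattice]
  simp only [det2, toVec]
  constructor
  · rintro ⟨s, t, h0, h1⟩
    refine ⟨t, ?_⟩
    simp
    linear_combination -h1 + (k : ℤ) * h0
  · rintro ⟨t, ht⟩
    refine ⟨v 0, t, by ring, ?_⟩
    simp at ht
    linear_combination -ht

lemma latticeOf_zero (n : ℕ) : latticeOf !![n, 0; 0, 1] = LatticeCode.lattice (n, 0, 1) := by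
  ext v
  rw [mem_latticeOf, LatticeCode.lattice, mem_slopeLattice]
  simp only [det2, toVec]
  constructor
  · rintro ⟨s, t, h0, -⟩
    refine ⟨-s, ?_⟩
    simp
    linear_combination -h0
  · rintro ⟨s, hs⟩
    refine ⟨-s, v 1, ?_, by ring⟩
    simp at hs
    linear_combination hs

lemma latticeOf_two : latticeOf !![2, 0; 1, 2] = LatticeCode.lattice (4, 2, 1) := by
  ext v
  rw [mem_latticeOf, LatticeCode.lattice, mem_slopeLattice]
  simp only [det2, toVec]
  constructor
  · rintro ⟨s, t, h0, h1⟩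
    refine ⟨t, ?_⟩
    simp
    linear_combination h0 - 2 * h1
  · rintro ⟨t, ht⟩
    simp at ht
    exact ⟨v 1 - 2 * t, t, by omega, by omega⟩

/-- The row of the table that encodes `coveringFour`. -/
def rowFour : List LatticeCode :=
  [(4, 0, 1), (4, 1, 0), (4, 1, 1), (4, 1, 2), (4, 1, 3), (4, 2, 1)]

/-- The row of the table that encodes `coveringFive`. -/
def rowFive : List LatticeCode :=
  [(5, 0, 1), (5, 1, 0), (5, 1, 1), (5, 1, 2), (5, 1, 3), (5, 1, 4)]

lemma coveringFour_eq : coveringFour = coverOf rowFour := by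
  have h := latticeOf_one 4
  have h0 := h 0
  have h1 := h 1
  have h2 := h 2
  have h3 := h 3
  have h4 := latticeOf_zero 4
  push_cast at h0 h1 h2 h3 h4
  rw [coveringFour, h0, h1, h2, h3, h4, latticeOf_two]
  ext Λ
  simp only [coverOf, rowFour, Set.mem_insert_iff, Set.mem_singleton_iff, Set.mem_ofPred_eq,
    List.map_cons, List.map_nil, List.mem_cons, List.not_mem_nil]
  tauto

lemma coveringFive_eq : coveringFive = coverOf rowFive := by
  have h := latticeOf_one 5
  have h0 := h 0
  have h1 := h 1
  have h2 := h 2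
  have h3 := h 3
  have h4 := h 4
  have h5 := latticeOf_zero 5
  push_cast at h0 h1 h2 h3 h4 h5
  rw [coveringFive, h0, h1, h2, h3, h4, h5]
  ext Λ
  simp only [coverOf, rowFive, Set.mem_insert_iff, Set.mem_singleton_iff, Set.mem_ofPred_eq,
    List.map_cons, List.map_nil, List.mem_cons, List.not_mem_nil]
  tauto

theorem mainTheorem4 :
    (minimalCoverings 6).ncard = 40 ∧
    {C | C ∈ minimalCoverings 6 ∧ ∀ Λ ∈ C, 4 ≤ Λ.index} = {coveringFour, coveringFive} ∧
    coveringFour ≠ coveringFive ∧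
    {C | C ∈ minimalCoverings 6 ∧ ∃ Λ ∈ C, ∃ p : ℕ, p.Prime ∧ 5 ≤ p ∧ p ∣ Λ.index} =
      {coveringFive} := by
  have hmem : ∀ {C}, C ∈ minimalCoverings 6 ↔ ∃ row ∈ coverTable, coverOf row = C := by
    intro C
    rw [minimalCoverings_six, Set.mem_ofPred_eq, List.mem_map]
  have hindex : ∀ row ∈ coverTable, ∀ c ∈ row, c.lattice.index = c.1 := by
    intro row hrow c hc
    obtain ⟨-, -, N, -, hval, -⟩ := coverTable_valid row hrow
    exact (hval c hc).index_lattice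
  have hfour : rowFour ∈ coverTable := by decide +kernel
  have hfive : rowFive ∈ coverTable := by decide +kernel
  have hge : ∀ row ∈ coverTable, (∀ c ∈ row, 4 ≤ c.1) ↔ row = rowFour ∨ row = rowFive := by
    decide +kernel
  have hdvd : ∀ row ∈ coverTable, row = rowFive ∨ ∀ c ∈ row, c.1 ∣ 2 ^ 4 * 3 ^ 2 := by
    decide +kernel
  rw [coveringFour_eq, coveringFive_eq]
  refine ⟨ncard_minimalCoverings_six, ?_, ?_, ?_⟩
  · ext C
    rw [Set.mem_ofPred_eq, Set.mem_insert_iff, Set.mem_singleton_iff]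
    constructor
    · rintro ⟨hC, h⟩
      obtain ⟨row, hrow, rfl⟩ := hmem.1 hC
      refine ((hge row hrow).1 fun c hc => ?_).imp (congrArg _) (congrArg _)
      rw [← hindex row hrow c hc]
      exact h _ (mem_coverOf.2 ⟨c, hc, rfl⟩)
    · intro h
      obtain ⟨row, hrow, hor, rfl⟩ : ∃ row ∈ coverTable, (row = rowFour ∨ row = rowFive) ∧
          coverOf row = C := by
        rcases h with rfl | rfl
        · exact ⟨_, hfour, .inl rfl, rfl⟩
        · exact ⟨_, hfive, .inr rfl, rfl⟩
      refine ⟨hmem.2 ⟨row, hrow, rfl⟩, fun Λ hΛ => ?_⟩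
      obtain ⟨c, hc, rfl⟩ := mem_coverOf.1 hΛ
      rw [hindex row hrow c hc]
      exact (hge row hrow).2 hor c hc
  · intro heq
    -- `20` is a common multiple of the indices `4` and `5`
    have hval : ∀ row ∈ [rowFour, rowFive], ∀ c ∈ row, c.IsValid 20 := by decide +kernel
    have := (sameCover_iff (hval rowFour (by simp)) (hval rowFive (by simp))).2 heq
    revert this
    decide +kernel
  · ext C
    rw [Set.mem_ofPred_eq, Set.mem_singleton_iff]
    constructor
    · rintro ⟨hC, Λ, hΛ, p, hp, h5, hpd⟩
      obtain ⟨row, hrow, rfl⟩ := hmem.1 hC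
      rcases hdvd row hrow with rfl | h
      · rfl
      obtain ⟨c, hc, rfl⟩ := mem_coverOf.1 hΛ
      rw [hindex row hrow c hc] at hpd
      rcases (Nat.Prime.dvd_mul hp).1 (hpd.trans (h c hc)) with h2 | h3
      · have := Nat.le_of_dvd (by norm_num) (hp.dvd_of_dvd_pow h2)
        omega
      · have := Nat.le_of_dvd (by norm_num) (hp.dvd_of_dvd_pow h3)
        omega
    · rintro rfl
      have hc : ((5, 0, 1) : LatticeCode) ∈ rowFive := by simp [rowFive]
      refine ⟨hmem.2 ⟨_, hfive, rfl⟩, _, mem_coverOf.2 ⟨_, hc, rfl⟩, 5, by norm_num, le_rfl, ?_⟩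
      rw [hindex _ hfive _ hc]
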